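/- Let $a,M,e,\Lambda,q,\mu,m\in\mathbb R$ with $\Lambda\neq0$, $\mu\neq 0$, and $\omega,\lambda\in\mathbb C$ (black hole rotation, mass, charge and cosmological constant; fermion charge, mass, azimuthal number and energy; separation constant). Put $\Xi=1+\frac{a^2\Lambda}{3}$, $$\Delta(r)=\Bigl(1-\tfrac{\Lambda}{3}r^2\Bigr)(r^2+a^2)-2Mr+e^2,\qquad K(r)=\Xi[(r^2+a^2)\omega-ma]+eqr .$$ The radial equation of a massive charged fermion in the Kerr–Newman–(anti) de Sitter spacetime is $$\Delta R''+\Bigl(\tfrac12\Delta'-\tfrac{i\mu\Delta}{\lambda+i\mu r}\Bigr)R'+\Bigl(\tfrac{K^2+\frac i2K\Delta'}{\Delta}-\tfrac{\mu K}{\lambda+i\mu r}-2i\omega\Xi r-ieq-\mu^2r^2-\lambda^2\Bigr)R=0. \tag{1}$$ Assume that $\Delta$ has four distinct zeros $r_1=r_+$, $r_2=r_-$ (real) and $r_3,r_4$ (real or complex), and that $r_5:=i\lambda/\mu$, the zero of $\lambda+i\mu r$, is none of them. Put $z_j=\frac{r_j-r_+}{r_--r_+}$ for $1\le j\le5$ and,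 for $1\le j\le 4$, with all functions evaluated at $r_j$, $$Q_j=\frac{K^2}{\Delta'^2}+\frac{iK}{2\Delta'},\qquad L_j=(r_--r_+)\Bigl[\frac{2KK'\Delta'-K^2\Delta''}{\Delta'^3}+\frac{iK'}{2\Delta'}-\frac1{\Delta'}\Bigl(\frac{\mu K}{\lambda+i\mu r_j}+2i\omega\Xi r_j+ieq+\mu^2r_j^2+\lambda^2\Bigr)\Bigr],$$ and $L_5=i(r_--r_+)K(r_5)/\Delta(r_5)$. For $1\le j\le4$ let $\mu_j$ be either root of $s(s-1)+\frac12s+Q_j=0$. Then $z_1=0$, $z_2=1$, the points $z_1,\dots,z_5$ are distinct, and with $r=r_++z(r_--r_+)$ one has $\Delta(r)=-\frac\Lambda3(r_--r_+)^4z(z-1)(z-z_3)(z-z_4)$. Moreover, with $z$ ranging over any open set $U$ of $\mathbb R$ or of $\mathbb C$ that contains none of $z_1,\dots,z_5$: (a) $R$ solves (1) on the image of $U$ if and only if $R_-(z)=R(r_++z(r_--r_+))$ solves on $U$ $$R_-''+\Bigl[\tfrac12\sum_{j=1}^4\tfrac1{z-z_j}-\tfrac1{z-z_5}\Bigr]R_-'+\Bigl[\sum_{j=1}^4\tfrac{Q_j}{(z-z_j)^2}+\sum_{j=1}^5\tfrac{L_j}{z-z_j}\Bigr]R_-=0.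 \tag{2}$$ The exponents of (2) are $\{\mu_j,\frac12-\mu_j\}$ at $z_j$ for $j\le4$, and $\{0,2\}$ at $z_5$. (b) If $R_-(z)=z^{\mu_1}(z-1)^{\mu_2}(z-z_3)^{\mu_3}(z-z_4)^{\mu_4}\overline R_-(z)$ on $U$, for any differentiable branches of the logarithms of $z-z_j$ on $U$, then $R$ solves (1) on the image of $U$ if and only if $\overline R_-$ solves on $U$ $$\overline R_-''+\Bigl[\sum_{j=1}^4\tfrac{1+4\mu_j}{2(z-z_j)}-\tfrac1{z-z_5}\Bigr]\overline R_-'+\Bigl[\sum_{j=1}^5\tfrac{L_j'}{z-z_j}\Bigr]\overline R_-=0, \tag{3}$$ $$L_j'=L_j+\sum_{k\le4,\,k\ne j}\frac{4\mu_j\mu_k+\mu_j+\mu_k}{2(z_j-z_k)}-\frac{\mu_j}{z_j-z_5}\ (j\le4),\qquad L_5'=L_5-\sum_{k=1}^4\frac{\mu_k}{z_5-z_k}.$$ (c) Equation (3) is Fuchsian (every point of $\mathbb C\cup\{\infty\}$ is an ordinary or a regular singular point), and every point of $\mathbb C\setminus\{0,1,z_3,z_4,z_5\}$ is ordinary. Its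 exponents are $\{0,\frac12-2\mu_j\}$ at $z_j$, $j\le4$, and $\{0,2\}$ at $z_5$. The point $z_5$ is a regular singular point, and so is each $z_j$, $j\le4$, for which $\mu_j\neq-\frac14$ or for which $\omega$ and $r_j$ are real. In particular, if $\omega$ and all $r_1,\dots,r_4$ are real, or if no $\mu_j$ equals $-\frac14$, then (3) has exactly the five finite singular points $0,1,z_3,z_4,z_5$, all regular. -/

import Mathlib

open Filter Topology

noncomputable section

/-! ### Linear second-order equations and their singular points -/

/-- `y` is twice differentiable at every point of the (open) set `U` and satisfies
`A y'' + B y' + C y = 0` there. The independent variable runs over `𝕜`, which is `ℝ` or `ℂ`. -/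
def IsSolutionOn {𝕜 : Type*} [RCLike 𝕜] [NormedAlgebra 𝕜 ℂ]
    (A B C : ℂ → ℂ) (U : Set 𝕜) (y : 𝕜 → ℂ) : Prop :=
  ∃ y₁ y₂ : 𝕜 → ℂ, ∀ x ∈ U, HasDerivAt y (y₁ x) x ∧ HasDerivAt y₁ (y₂ x) x ∧
    A (algebraMap 𝕜 ℂ x) * y₂ x + B (algebraMap 𝕜 ℂ x) * y₁ x + C (algebraMap 𝕜 ℂ x) * y x = 0

/-- Near `z₀` the equation `y'' + p y' + q y = 0` has the form
`y'' + f / (z - z₀) y' + g / (z - z₀)² y = 0` with `f`, `g` analytic at `z₀`,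
`f z₀ = α`, `g z₀ = β`. -/
def HasRegularForm (p q : ℂ → ℂ) (z₀ α β : ℂ) : Prop :=
  ∃ f g : ℂ → ℂ, AnalyticAt ℂ f z₀ ∧ AnalyticAt ℂ g z₀ ∧ f z₀ = α ∧ g z₀ = β ∧
    ∀ᶠ z in 𝓝[≠] z₀, p z = f z / (z - z₀) ∧ q z = g z / (z - z₀) ^ 2

/-- `y'' + p y' + q y = 0` has at `z₀` the exponents `s₁`, `s₂`: they are the roots, with
multiplicity, of the indicial equation `s (s - 1) + α s + β = 0`. -/
def HasExponents (p q : ℂ → ℂ) (z₀ s₁ s₂ : ℂ) : Prop :=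
  ∃ α β : ℂ, HasRegularForm p q z₀ α β ∧
    ∀ s : ℂ, s * (s - 1) + α * s + β = (s - s₁) * (s - s₂)

/-- `z₀` is an ordinary point: `p` and `q` are analytic there (up to removable singularities). -/
def IsOrdinaryPoint (p q : ℂ → ℂ) (z₀ : ℂ) : Prop :=
  ∃ f g : ℂ → ℂ, AnalyticAt ℂ f z₀ ∧ AnalyticAt ℂ g z₀ ∧
    ∀ᶠ z in 𝓝[≠] z₀, p z = f z ∧ q z = g z

/-- `z₀` is a regular singular point: not ordinary, and with poles of order at most `1` and `2`. -/
def IsRegularSingularPoint (p q : ℂ → ℂ) (z₀ : ℂ) : Prop :=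
  ¬ IsOrdinaryPoint p q z₀ ∧ ∃ α β : ℂ, HasRegularForm p q z₀ α β

/-- The equation `y'' + p y' + q y = 0` is Fuchsian: every point of `ℂ` is an ordinary or a regular
singular point, and so is `∞`, that is, the point `t = 0` after the substitution `z = 1 / t`, which
turns the coefficients into `2 / t - p (1 / t) / t²` and `q (1 / t) / t⁴`. -/
def IsFuchsian (p q : ℂ → ℂ) : Prop :=
  (∀ z₀ : ℂ, IsOrdinaryPoint p q z₀ ∨ IsRegularSingularPoint p q z₀) ∧
  (IsOrdinaryPoint (fun t => 2 / t - p t⁻¹ / t ^ 2) (fun t => q t⁻¹ / t ^ 4) 0 ∨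
    IsRegularSingularPoint (fun t => 2 / t - p t⁻¹ / t ^ 2) (fun t => q t⁻¹ / t ^ 4) 0)

/-! ### The radial equation in the Kerr–Newman–de Sitter spacetime -/

/-- Rotation parameter `a`, mass `M`, electric charge `e` and cosmological constant `Λ` of the
black hole; charge `q`, mass `μ`, azimuthal number `m` and energy `ω` of the fermion; separation
constant `lam`. -/
structure KNdS where
  a : ℝ
  M : ℝ
  e : ℝ
  Λ : ℝ
  q : ℝ
  μ : ℝ
  m : ℝ
  ω : ℂ
  lam : ℂ

namespace KNdS

/-- `Ξ = 1 + a² Λ / 3`. -/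
def Xi (P : KNdS) : ℂ := 1 + P.a ^ 2 * P.Λ / 3

/-- `Δ_r = (1 - Λ r² / 3) (r² + a²) - 2 M r + e²`. -/
def Delta (P : KNdS) (r : ℂ) : ℂ :=
  (1 - P.Λ / 3 * r ^ 2) * (r ^ 2 + P.a ^ 2) - 2 * P.M * r + P.e ^ 2

/-- `K(r) = Ξ [(r² + a²) ω - m a] + e q r`. -/
def K (P : KNdS) (r : ℂ) : ℂ :=
  P.Xi * ((r ^ 2 + P.a ^ 2) * P.ω - P.m * P.a) + P.e * P.q * r

/-- Coefficient of `R'` in the radial equation `Δ_r R'' + B R' + C R = 0`. -/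
def radialB (P : KNdS) (r : ℂ) : ℂ :=
  1 / 2 * deriv P.Delta r - Complex.I * P.μ * (P.Delta r / (P.lam + Complex.I * P.μ * r))

/-- Coefficient of `R` in the radial equation `Δ_r R'' + B R' + C R = 0`. -/
def radialC (P : KNdS) (r : ℂ) : ℂ :=
  (P.K r ^ 2 + Complex.I * P.K r / 2 * deriv P.Delta r) / P.Delta r
    - P.μ * P.K r / (P.lam + Complex.I * P.μ * r)
    - 2 * Complex.I * P.ω * r * P.Xi - Complex.I * P.e * P.q - P.μ ^ 2 * r ^ 2 - P.lam ^ 2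

/-- The radii `r₊, r₋, r_Λ⁺, r_Λ⁻`, in this order. -/
def radius (rp rm : ℝ) (r₃ r₄ : ℂ) : Fin 4 → ℂ := ![(rp : ℂ), (rm : ℂ), r₃, r₄]

/-- `r₅ = i λ / μ`, the zero of `λ + i μ r`. -/
def r₅ (P : KNdS) : ℂ := Complex.I * P.lam / P.μ

/-- The affine coordinate `z = (r - r₊) / (r₋ - r₊)` of a radius `r`. -/
def zOf (rp rm : ℝ) (r : ℂ) : ℂ := (r - rp) / (rm - rp)

/-- Coefficient of `(z - zᵢ)⁻²`, where `rᵢ` is a zero of `Δ_r`. -/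
def Q (P : KNdS) (rᵢ : ℂ) : ℂ :=
  P.K rᵢ ^ 2 / deriv P.Delta rᵢ ^ 2 + Complex.I * P.K rᵢ / (2 * deriv P.Delta rᵢ)

/-- Coefficient of `(z - zᵢ)⁻¹`, where `rᵢ` is a zero of `Δ_r`. -/
def L (P : KNdS) (rp rm : ℝ) (rᵢ : ℂ) : ℂ :=
  (rm - rp) *
    ((2 * P.K rᵢ * deriv P.K rᵢ * deriv P.Delta rᵢ - P.K rᵢ ^ 2 * deriv (deriv P.Delta) rᵢ)
        / deriv P.Delta rᵢ ^ 3
      + Complex.I * deriv P.K rᵢ / (2 * deriv P.Delta rᵢ)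
      - (P.μ * P.K rᵢ / (P.lam + Complex.I * P.μ * rᵢ) + 2 * Complex.I * P.ω * P.Xi * rᵢ
          + Complex.I * P.e * P.q + P.μ ^ 2 * rᵢ ^ 2 + P.lam ^ 2) / deriv P.Delta rᵢ)

/-- Coefficient of `(z - z₅)⁻¹`. -/
def L₅ (P : KNdS) (rp rm : ℝ) : ℂ :=
  Complex.I * (rm - rp) * P.K P.r₅ / P.Delta P.r₅

/-- Coefficient of `R₋'` in the radial equation in the variable `z`; here `z = (z₁, …, z₄)`. -/
def preB (z : Fin 4 → ℂ) (z₅ x : ℂ) : ℂ :=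
  1 / 2 * ∑ i, 1 / (x - z i) - 1 / (x - z₅)

/-- Coefficient of `R₋` in the radial equation in the variable `z`. -/
def preC (z Q L : Fin 4 → ℂ) (z₅ L₅ x : ℂ) : ℂ :=
  ∑ i, Q i / (x - z i) ^ 2 + ∑ i, L i / (x - z i) + L₅ / (x - z₅)

/-- `L'ᵢ`, for `i = 1, …, 4`; here `ν i` is the exponent of `z - zᵢ` in the F-homotopic
transformation. -/
def L' (z ν L : Fin 4 → ℂ) (z₅ : ℂ) (i : Fin 4) : ℂ :=
  L i + ∑ j ∈ Finset.univ.erase i, (4 * ν i * ν j + ν i + ν j) / (2 * (z i - z j))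
    - ν i / (z i - z₅)

/-- `L'₅`. -/
def L₅' (z ν : Fin 4 → ℂ) (z₅ L₅ : ℂ) : ℂ := L₅ - ∑ i, ν i / (z₅ - z i)

/-- Coefficient of `R̄₋'` in the transformed equation. -/
def finalB (z ν : Fin 4 → ℂ) (z₅ x : ℂ) : ℂ :=
  ∑ i, (1 + 4 * ν i) / (2 * (x - z i)) - 1 / (x - z₅)

/-- Coefficient of `R̄₋` in the transformed equation. -/
def finalC (z ν L : Fin 4 → ℂ) (z₅ L₅ x : ℂ) : ℂ :=
  ∑ i, L' z ν L z₅ i / (x - z i) + L₅' z ν z₅ L₅ / (x - z₅)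

end KNdS

end

/-! Dividing (1) by `Δ` leaves rational coefficients, and the theorem amounts to their partial
fractions. Since `Λ ≠ 0`, `Δ` is a quartic with four simple zeros. Hence `Δ'/Δ` is a sum of four
simple poles, while `(K² + iKΔ'/2)/Δ²` has double poles `Q_j` at these zeros plus simple poles. The
mass terms over `Δ`, and `K/((r - r₅)Δ)`, have simple poles only. The affine substitution rescales a
simple pole in the coefficient of `R` by `r₋ - r₊` and fixes the rest, which gives (2)
(`radialB_div_Delta`, `radialC_div_Delta`, `isSolutionOn_radial_iff`).

Writing a solution as `E w` with `E'/E = s = ∑ μ_j/(z - z_j)` changes the coefficients `p`, `q` into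
`p + 2s` and `q + ps + s² + s'`. The double pole at `z_j` then has coefficient `μ_j(μ_j - 1) + μ_j/2
+ Q_j = 0`, and the products of distinct simple poles split into the corrections in `L'_j`
(`finalC_eq`).

The exponents at finite points are read off from the polar parts. At infinity the pole bound needs
`∑ L'_j = 0`. The corrections cancel in pairs (`sum_L'`), and `∑ L_j = 0` (`sum_L`) because the
numerators have low enough degree for the residues to sum to zero. A point `z_j` is certainly
singular if the residue `(1 + 4μ_j)/2` of the first-order coefficient is nonzero, and for real data
`μ_j = -1/4` would force `t² + 3/16 = 0` with `t` real. -/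

/-! ### Affine change of variable and multiplication by a factor, over the reals or the complex
numbers. -/

theorem hasDerivAt_algebraMap_complex {𝕜 : Type*} [RCLike 𝕜] [NormedAlgebra 𝕜 ℂ] (x : 𝕜) :
    HasDerivAt (fun t : 𝕜 => algebraMap 𝕜 ℂ t) 1 x := by
  have h := (algebraMapCLM 𝕜 ℂ).hasDerivAt (x := x)
  rw [show algebraMapCLM 𝕜 ℂ 1 = 1 from map_one (algebraMap 𝕜 ℂ)] at h
  exact h

/-- Pulling a solution back along `x ↦ b + x * c`. -/
theorem IsSolutionOn.comp_affine {𝕜 : Type*} [RCLike 𝕜] [NormedAlgebra 𝕜 ℂ]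
    {A B C A' B' C' : ℂ → ℂ} {U V : Set 𝕜} {R S : 𝕜 → ℂ} {b c : 𝕜}
    (hR : IsSolutionOn A B C V R) (hU : IsOpen U) (hUV : ∀ x ∈ U, b + x * c ∈ V)
    (hS : ∀ x ∈ U, S x = R (b + x * c))
    (hcoef : ∀ x ∈ U, ∀ y y₁ y₂ : ℂ,
      A (algebraMap 𝕜 ℂ (b + x * c)) * y₂ + B (algebraMap 𝕜 ℂ (b + x * c)) * y₁
        + C (algebraMap 𝕜 ℂ (b + x * c)) * y = 0 →
      A' (algebraMap 𝕜 ℂ x) * (algebraMap 𝕜 ℂ c * (algebraMap 𝕜 ℂ c * y₂))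
        + B' (algebraMap 𝕜 ℂ x) * (algebraMap 𝕜 ℂ c * y₁) + C' (algebraMap 𝕜 ℂ x) * y = 0) :
    IsSolutionOn A' B' C' U S := by
  obtain ⟨y₁, y₂, h⟩ := hR
  have hg : ∀ x : 𝕜, HasDerivAt (fun t => b + t * c) c x := fun x => by
    simpa using ((hasDerivAt_id x).mul_const c).const_add b
  refine ⟨fun x => algebraMap 𝕜 ℂ c * y₁ (b + x * c),
    fun x => algebraMap 𝕜 ℂ c * (algebraMap 𝕜 ℂ c * y₂ (b + x * c)), fun x hx => ?_⟩
  obtain ⟨h₁, h₂, h₃⟩ := h _ (hUV x hx)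
  refine ⟨?_, ?_, ?_⟩
  · have := HasDerivAt.scomp x h₁ (hg x)
    rw [Algebra.smul_def] at this
    refine this.congr_of_eventuallyEq ?_
    filter_upwards [hU.mem_nhds hx] with t ht using hS t ht
  · have := HasDerivAt.scomp x h₂ (hg x)
    rw [Algebra.smul_def] at this
    exact this.const_mul _
  · rw [hS x hx]
    exact hcoef x hx _ _ _ h₃

/-- The equation for `R` on the image of `U` under `x ↦ b + x * c` is equivalent to the equation
for `R (b + x * c)` on `U`. -/
theorem isSolutionOn_image_affine_iff {𝕜 : Type*} [RCLike 𝕜] [NormedAlgebra 𝕜 ℂ]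
    {A B C p q : ℂ → ℂ} {U : Set 𝕜} {R S : 𝕜 → ℂ} {b c : 𝕜} (hc : c ≠ 0) (hU : IsOpen U)
    (hS : ∀ x ∈ U, S x = R (b + x * c))
    (hA : ∀ x ∈ U, A (algebraMap 𝕜 ℂ (b + x * c)) ≠ 0)
    (hB : ∀ x ∈ U, algebraMap 𝕜 ℂ c * B (algebraMap 𝕜 ℂ (b + x * c)) =
      A (algebraMap 𝕜 ℂ (b + x * c)) * p (algebraMap 𝕜 ℂ x))
    (hC : ∀ x ∈ U, algebraMap 𝕜 ℂ c ^ 2 * C (algebraMap 𝕜 ℂ (b + x * c)) =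
      A (algebraMap 𝕜 ℂ (b + x * c)) * q (algebraMap 𝕜 ℂ x)) :
    IsSolutionOn A B C ((fun x => b + x * c) '' U) R ↔ IsSolutionOn 1 p q U S := by
  have hc' : algebraMap 𝕜 ℂ c ≠ 0 := by simpa using hc
  constructor
  · intro h
    refine h.comp_affine hU (fun x hx => ⟨x, hx, rfl⟩) hS fun x hx y y₁ y₂ e => ?_
    apply mul_left_cancel₀ (hA x hx)
    simp only [Pi.one_apply]
    linear_combination algebraMap 𝕜 ℂ c ^ 2 * e - algebraMap 𝕜 ℂ c * y₁ * hB x hx - y * hC x hx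
  · intro h
    -- The inverse map has the same affine shape, with constants `-b * c⁻¹` and `c⁻¹`, so the
    -- converse is again an instance of `comp_affine`.
    have hinv : ∀ x : 𝕜, -b * c⁻¹ + (b + x * c) * c⁻¹ = x := fun x => by field_simp; ring
    have hinv' : ∀ r : 𝕜, b + (-b * c⁻¹ + r * c⁻¹) * c = r := fun x => by field_simp; ring
    have himg : (fun x => b + x * c) '' U = (fun r => -b * c⁻¹ + r * c⁻¹) ⁻¹' U := by
      ext r
      constructor
      · rintro ⟨x, hx, rfl⟩
        simpa only [Set.mem_preimage, hinv] using hx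
      · exact fun hr => ⟨_, hr, hinv' r⟩
    refine h.comp_affine (b := -b * c⁻¹) (c := c⁻¹) ?_ ?_ ?_ ?_
    · rw [himg]
      exact hU.preimage (by fun_prop)
    · rintro _ ⟨x, hx, rfl⟩
      simpa only [hinv] using hx
    · rintro _ ⟨x, hx, rfl⟩
      simp only [hinv, hS x hx]
    · rintro _ ⟨x, hx, rfl⟩ y y₁ y₂ e
      simp only [hinv, Pi.one_apply] at e ⊢
      have h1 : algebraMap 𝕜 ℂ c⁻¹ = (algebraMap 𝕜 ℂ c)⁻¹ := map_inv₀ _ _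
      rw [h1]
      have hk : algebraMap 𝕜 ℂ c * (algebraMap 𝕜 ℂ c)⁻¹ = 1 := mul_inv_cancel₀ hc'
      -- After multiplication by `c²`, the left-hand side becomes `A (y₂ + p y₁ + q y)` by `hB` and
      -- `hC`.
      apply mul_left_cancel₀ (pow_ne_zero 2 hc')
      set k := algebraMap 𝕜 ℂ c
      linear_combination A (algebraMap 𝕜 ℂ (b + x * c)) * e + k * k⁻¹ * y₁ * hB x hx + y * hC x hx
        + A (algebraMap 𝕜 ℂ (b + x * c)) * (y₂ * (k * k⁻¹ + 1) +
          p (algebraMap 𝕜 ℂ x) * y₁) * hk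

/-- Multiplying a solution by a function `E` with `E' = s E`. -/
theorem IsSolutionOn.mul_of_logDeriv {𝕜 : Type*} [RCLike 𝕜] [NormedAlgebra 𝕜 ℂ]
    {p q p' q' : ℂ → ℂ} {U : Set 𝕜} {E s s' w y : 𝕜 → ℂ}
    (hw : IsSolutionOn 1 p' q' U w) (hU : IsOpen U)
    (hE : ∀ x ∈ U, HasDerivAt E (s x * E x) x) (hs : ∀ x ∈ U, HasDerivAt s (s' x) x)
    (hy : ∀ x ∈ U, y x = E x * w x)
    (hp : ∀ x ∈ U, p' (algebraMap 𝕜 ℂ x) = p (algebraMap 𝕜 ℂ x) + 2 * s x)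
    (hq : ∀ x ∈ U, q' (algebraMap 𝕜 ℂ x) =
      q (algebraMap 𝕜 ℂ x) + p (algebraMap 𝕜 ℂ x) * s x + s x ^ 2 + s' x) :
    IsSolutionOn 1 p q U y := by
  obtain ⟨w₁, w₂, h⟩ := hw
  refine ⟨fun x => s x * E x * w x + E x * w₁ x,
    fun x => (s' x * E x + s x * (s x * E x)) * w x + s x * E x * w₁ x
      + (s x * E x * w₁ x + E x * w₂ x), fun x hx => ?_⟩
  obtain ⟨h₁, h₂, h₃⟩ := h x hx
  refine ⟨((hE x hx).mul h₁).congr_of_eventuallyEq ?_,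
    (((hs x hx).mul (hE x hx)).mul h₁).add ((hE x hx).mul h₂), ?_⟩
  · filter_upwards [hU.mem_nhds hx] with t ht using hy t ht
  · rw [hp x hx, hq x hx] at h₃
    rw [hy x hx]
    simp only [Pi.one_apply] at h₃ ⊢
    linear_combination E x * h₃

/-- If `y = E w` with `E' = s E`, then `y'' + p y' + q y = 0` is equivalent to
`w'' + (p + 2 s) w' + (q + p s + s² + s') w = 0`. -/
theorem isSolutionOn_mul_iff {𝕜 : Type*} [RCLike 𝕜] [NormedAlgebra 𝕜 ℂ]
    {p q p' q' : ℂ → ℂ} {U : Set 𝕜} {E s s' w y : 𝕜 → ℂ} (hU : IsOpen U)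
    (hE₀ : ∀ x ∈ U, E x ≠ 0)
    (hE : ∀ x ∈ U, HasDerivAt E (s x * E x) x) (hs : ∀ x ∈ U, HasDerivAt s (s' x) x)
    (hy : ∀ x ∈ U, y x = E x * w x)
    (hp : ∀ x ∈ U, p' (algebraMap 𝕜 ℂ x) = p (algebraMap 𝕜 ℂ x) + 2 * s x)
    (hq : ∀ x ∈ U, q' (algebraMap 𝕜 ℂ x) =
      q (algebraMap 𝕜 ℂ x) + p (algebraMap 𝕜 ℂ x) * s x + s x ^ 2 + s' x) :
    IsSolutionOn 1 p q U y ↔ IsSolutionOn 1 p' q' U w := by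
  refine ⟨fun h => ?_, fun h => h.mul_of_logDeriv hU hE hs hy hp hq⟩
  -- The converse is the same statement for `1/E`, whose logarithmic derivative is `-s`.
  refine h.mul_of_logDeriv (E := fun x => (E x)⁻¹) (s := fun x => -s x) (s' := fun x => -s' x) hU
    (fun x hx => ?_) (fun x hx => (hs x hx).neg) (fun x hx => ?_) (fun x hx => ?_) (fun x hx => ?_)
  · have := (hE x hx).fun_inv (hE₀ x hx)
    have he : -(s x * E x) / E x ^ 2 = -s x * (E x)⁻¹ := by
      have := hE₀ x hx
      field_simp
    rw [he] at this
    exact this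
  · rw [hy x hx, inv_mul_cancel_left₀ (hE₀ x hx)]
  · rw [hp x hx]; ring
  · rw [hp x hx, hq x hx]; ring

/-! ### Partial fractions and residue sums for denominators with simple roots. -/

-- Uniqueness in Hermite interpolation: the pairwise coprime squares `(X - v i)²` all divide `p`, so
-- a nonzero `p` would have degree at least twice the number of nodes.
open Polynomial in
theorem eq_zero_of_double_roots {ι : Type*} [Fintype ι] {v : ι → ℂ} (hv : Function.Injective v)
    {p : ℂ[X]} (hdeg : p.degree < (2 * Fintype.card ι : ℕ))
    (h₀ : ∀ i, p.eval (v i) = 0) (h₁ : ∀ i, p.derivative.eval (v i) = 0) : p = 0 := by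
  by_contra hp
  have hdvd : ∏ i, (X - C (v i)) ^ 2 ∣ p := by
    refine Finset.prod_dvd_of_coprime (fun i _ j _ hij => ?_) fun i _ => ?_
    · exact (pairwise_coprime_X_sub_C hv hij).pow
    · rw [← le_rootMultiplicity_iff hp]
      exact (one_lt_rootMultiplicity_iff_isRoot hp).2 ⟨h₀ i, h₁ i⟩
  have hle := degree_le_of_dvd hdvd hp
  rw [degree_prod] at hle
  simp only [degree_pow, degree_X_sub_C] at hle
  refine absurd (lt_of_le_of_lt hle hdeg) (not_lt.2 ?_)
  simp [mul_comm]

open Polynomial in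
/-- Partial fractions of `N / W²`, where `W` has simple roots and `deg N < 2 deg W`. -/
theorem eval_div_sq_eq_partial_fractions {ι : Type*} [Fintype ι] [DecidableEq ι] {v : ι → ℂ}
    (hv : Function.Injective v) {k : ℂ} (hk : k ≠ 0) {W N : ℂ[X]}
    (hW : W = C k * ∏ i, (X - C (v i))) (hN : N.degree < (2 * Fintype.card ι : ℕ))
    {x : ℂ} (hx : ∀ i, x ≠ v i) :
    N.eval x / W.eval x ^ 2 =
      ∑ i, N.eval (v i) / W.derivative.eval (v i) ^ 2 / (x - v i) ^ 2 +
      ∑ i, (N.derivative.eval (v i) * W.derivative.eval (v i)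
        - N.eval (v i) * W.derivative.derivative.eval (v i)) / W.derivative.eval (v i) ^ 3
          / (x - v i) := by
  -- `g i` is `W / (X - v i)`; thus `W'(v i) = g i (v i)` and `W''(v i) = 2 (g i)'(v i)`.
  set g : ι → ℂ[X] := fun i => C k * ∏ j ∈ Finset.univ.erase i, (X - C (v j)) with hg
  have hWg : ∀ i, W = (X - C (v i)) * g i := fun i => by
    rw [hW, hg, ← Finset.mul_prod_erase _ _ (Finset.mem_univ i)]; ring
  have hW₀ : ∀ i, W.eval (v i) = 0 := fun i => by rw [hWg i]; simp
  have hW₁ : ∀ i, W.derivative.eval (v i) = (g i).eval (v i) := fun i => by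
    conv_lhs => rw [hWg i]
    simp
  have hW₂ : ∀ i, W.derivative.derivative.eval (v i) = 2 * (g i).derivative.eval (v i) := fun i => by
    conv_lhs => rw [hWg i]
    simp; ring
  have hne : ∀ i, (g i).eval (v i) ≠ 0 := fun i => by
    simp only [hg, eval_mul, eval_C, eval_prod, eval_sub, eval_X]
    refine mul_ne_zero hk (Finset.prod_ne_zero_iff.2 fun j hj => ?_)
    exact sub_ne_zero.2 fun h => (Finset.ne_of_mem_erase hj) (hv h).symm
  have hg₀ : ∀ i j, j ≠ i → (g j).eval (v i) = 0 := fun i j hij => by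
    simp only [hg, eval_mul, eval_C, eval_prod, eval_sub, eval_X]
    rw [Finset.prod_eq_zero (Finset.mem_erase.2 ⟨hij.symm, Finset.mem_univ i⟩) (by simp), mul_zero]
  set α : ι → ℂ := fun i => N.eval (v i) / W.derivative.eval (v i) ^ 2 with hα
  set β : ι → ℂ := fun i => (N.derivative.eval (v i) * W.derivative.eval (v i)
        - N.eval (v i) * W.derivative.derivative.eval (v i)) / W.derivative.eval (v i) ^ 3 with hβ
  -- The expansion multiplied by `W²`. Both sides have degree below twice the number of nodes, so it
  -- is enough to match values and first derivatives at each `v i`, where only the `i`-th summand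
  -- contributes.
  have key : N = ∑ i, (C (α i) * g i ^ 2 + C (β i) * (g i * W)) := by
    rw [← sub_eq_zero]
    refine eq_zero_of_double_roots hv ?_ (fun i => ?_) (fun i => ?_)
    · have hgd : ∀ i, (g i).degree = (Fintype.card ι - 1 : ℕ) := fun i => by
        simp [hg, degree_C hk, degree_prod, Finset.card_erase_of_mem]
      have hWd : W.degree = (Fintype.card ι : ℕ) := by
        simp [hW, degree_C hk, degree_prod]
      refine (degree_sub_le _ _).trans_lt (max_lt hN ?_)
      refine (degree_sum_le _ _).trans_lt ((Finset.sup_lt_iff (WithBot.bot_lt_coe _)).2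
        fun i _ => ?_)
      have hpos : 0 < Fintype.card ι := Fintype.card_pos_iff.2 ⟨i⟩
      refine (degree_add_le _ _).trans_lt (max_lt ?_ ?_)
      · refine (degree_mul_le _ _).trans_lt ((add_le_add_left degree_C_le _).trans_lt ?_)
        rw [zero_add, degree_pow, hgd, nsmul_eq_mul]
        norm_cast
        omega
      · refine (degree_mul_le _ _).trans_lt ((add_le_add_left degree_C_le _).trans_lt ?_)
        rw [zero_add, degree_mul, hgd, hWd]
        norm_cast
        omega
    · rw [eval_sub, eval_finsetSum, Finset.sum_eq_single i]
      · simp only [eval_add, eval_mul, eval_C, eval_pow, hW₀, hα, hW₁]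
        have := hne i
        field_simp
        ring
      · intro j _ hj
        simp [hg₀ i j hj]
      · simp
    · rw [derivative_sub, eval_sub, derivative_sum, eval_finsetSum, Finset.sum_eq_single i]
      · simp only [derivative_add, derivative_mul, derivative_C, derivative_pow, eval_add, eval_mul,
          eval_C, eval_pow, hW₀, hα, hβ, hW₁, hW₂, eval_zero]
        have := hne i
        simp
        field_simp
        ring
      · intro j _ hj
        simp [hg₀ i j hj, hW₀, pow_two]
      · simp
  have hWx : W.eval x ≠ 0 := by
    simp only [hW, eval_mul, eval_C, eval_prod, eval_sub, eval_X]
    exact mul_ne_zero hk (Finset.prod_ne_zero_iff.2 fun i _ => sub_ne_zero.2 (hx i))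
  conv_lhs => rw [key]
  rw [eval_finsetSum, Finset.sum_div, ← Finset.sum_add_distrib]
  refine Finset.sum_congr rfl fun i _ => ?_
  have h1 := sub_ne_zero.2 (hx i)
  have h2 : W.eval x = (x - v i) * (g i).eval x := by
    conv_lhs => rw [hWg i]
    simp
  have h3 : (g i).eval x ≠ 0 := fun h => hWx (by rw [h2, h, mul_zero])
  change _ = α i / _ + β i / _
  simp only [eval_add, eval_mul, eval_C, eval_pow, h2]
  generalize α i = A
  generalize β i = B
  field_simp

open Polynomial in
theorem derivative_eval_ne_zero_of_simple_roots {ι : Type*} [Fintype ι] [DecidableEq ι] {v : ι → ℂ}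
    (hv : Function.Injective v) {k : ℂ} (hk : k ≠ 0) {W : ℂ[X]}
    (hW : W = C k * ∏ i, (X - C (v i))) (i : ι) : W.derivative.eval (v i) ≠ 0 := by
  rw [hW, ← Finset.mul_prod_erase _ _ (Finset.mem_univ i)]
  simp only [derivative_mul, derivative_C, derivative_sub, derivative_X, eval_add, eval_mul,
    eval_C, eval_sub, eval_X, eval_prod, sub_self, zero_mul, zero_add,
    add_zero, sub_zero, one_mul]
  refine mul_ne_zero hk (Finset.prod_ne_zero_iff.2 fun j hj => ?_)
  exact sub_ne_zero.2 fun h => (Finset.ne_of_mem_erase hj) (hv h).symm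

open Polynomial in
/-- Partial fractions of `T / W`, where `W` has simple roots and `deg T < deg W`. -/
theorem eval_div_eq_partial_fractions {ι : Type*} [Fintype ι] [DecidableEq ι] {v : ι → ℂ}
    (hv : Function.Injective v) {k : ℂ} (hk : k ≠ 0) {W T : ℂ[X]}
    (hW : W = C k * ∏ i, (X - C (v i))) (hT : T.degree < (Fintype.card ι : ℕ))
    {x : ℂ} (hx : ∀ i, x ≠ v i) :
    T.eval x / W.eval x = ∑ i, T.eval (v i) / W.derivative.eval (v i) / (x - v i) := by
  have hW₀ : ∀ i, W.eval (v i) = 0 := fun i => by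
    simp only [hW, eval_mul, eval_prod, eval_sub, eval_X, eval_C]
    rw [Finset.prod_eq_zero (Finset.mem_univ i) (by simp), mul_zero]
  have hWx : W.eval x ≠ 0 := by
    simp only [hW, eval_mul, eval_C, eval_prod, eval_sub, eval_X]
    exact mul_ne_zero hk (Finset.prod_ne_zero_iff.2 fun i _ => sub_ne_zero.2 (hx i))
  have hW₁ := derivative_eval_ne_zero_of_simple_roots hv hk hW
  have hWd : W.degree = (Fintype.card ι : ℕ) := by simp [hW, degree_C hk, degree_prod]
  -- Since `T/W = TW/W²` and `TW` vanishes at every node, the double poles drop out.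
  have h := eval_div_sq_eq_partial_fractions (N := T * W) hv hk hW (by
    rw [degree_mul, hWd, two_mul, Nat.cast_add]
    exact WithBot.add_lt_add_right (by simp) hT) hx
  rw [eval_mul, pow_two, mul_div_mul_right _ _ hWx] at h
  rw [h]
  simp only [eval_mul, hW₀, mul_zero, zero_div, Finset.sum_const_zero, zero_add, derivative_mul,
    eval_add, zero_mul, sub_zero]
  refine Finset.sum_congr rfl fun i _ => ?_
  have := hW₁ i
  field_simp

theorem exists_forall_ne_complex {ι : Type*} [Finite ι] (v : ι → ℂ) : ∃ x, ∀ i, x ≠ v i := by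
  obtain ⟨x, hx⟩ := (Set.finite_range v).infinite_compl.nonempty
  exact ⟨x, fun i h => hx ⟨i, h.symm⟩⟩

open Polynomial in
/-- The residues of `N / W²` have sum zero when `deg N + 1 < 2 deg W`. -/
theorem sum_residues_div_sq_eq_zero {ι : Type*} [Fintype ι] [DecidableEq ι] {v : ι → ℂ}
    (hv : Function.Injective v) {k : ℂ} (hk : k ≠ 0) {W N : ℂ[X]}
    (hW : W = C k * ∏ i, (X - C (v i))) (hN : (X * N).degree < ((2 * Fintype.card ι : ℕ) : WithBot ℕ)) :
    ∑ i, (N.derivative.eval (v i) * W.derivative.eval (v i)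
        - N.eval (v i) * W.derivative.derivative.eval (v i)) / W.derivative.eval (v i) ^ 3 = 0 := by
  obtain ⟨x, hx⟩ := exists_forall_ne_complex v
  have hN' : N.degree < (2 * Fintype.card ι : ℕ) := by
    refine lt_of_le_of_lt ?_ hN
    rw [degree_mul, degree_X]
    exact le_add_of_nonneg_left zero_le_one
  have h₁ := eval_div_sq_eq_partial_fractions hv hk hW hN' hx
  -- The degree bound allows the expansion of `X N / W²` too. Subtracting it from `x` times the
  -- expansion of `N / W²`, at a single point `x`, leaves exactly the sum of the residues, with no
  -- limit at infinity.
  have h₂ := eval_div_sq_eq_partial_fractions hv hk hW hN hx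
  rw [eval_mul, eval_X, mul_div_assoc, h₁, ← sub_eq_zero, mul_add, Finset.mul_sum, Finset.mul_sum,
    ← Finset.sum_add_distrib, ← Finset.sum_add_distrib, ← Finset.sum_sub_distrib] at h₂
  rw [← h₂]
  refine Finset.sum_congr rfl fun i _ => ?_
  have := derivative_eval_ne_zero_of_simple_roots hv hk hW i
  have := sub_ne_zero.2 (hx i)
  simp only [derivative_mul, derivative_X, eval_add, eval_mul, eval_X, one_mul]
  field_simp
  ring

open Polynomial in
/-- The residues of `T / W` have sum zero when `deg T + 1 < deg W`. -/
theorem sum_residues_div_eq_zero {ι : Type*} [Fintype ι] [DecidableEq ι] {v : ι → ℂ}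
    (hv : Function.Injective v) {k : ℂ} (hk : k ≠ 0) {W T : ℂ[X]}
    (hW : W = C k * ∏ i, (X - C (v i))) (hT : (X * T).degree < ((Fintype.card ι : ℕ) : WithBot ℕ)) :
    ∑ i, T.eval (v i) / W.derivative.eval (v i) = 0 := by
  obtain ⟨x, hx⟩ := exists_forall_ne_complex v
  have hT' : T.degree < (Fintype.card ι : ℕ) := by
    refine lt_of_le_of_lt ?_ hT
    rw [degree_mul, degree_X]
    exact le_add_of_nonneg_left zero_le_one
  have h₁ := eval_div_eq_partial_fractions hv hk hW hT' hx
  have h₂ := eval_div_eq_partial_fractions hv hk hW hT hx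
  rw [eval_mul, eval_X, mul_div_assoc, h₁, ← sub_eq_zero, Finset.mul_sum,
    ← Finset.sum_sub_distrib] at h₂
  rw [← h₂]
  refine Finset.sum_congr rfl fun i _ => ?_
  have := derivative_eval_ne_zero_of_simple_roots hv hk hW i
  have := sub_ne_zero.2 (hx i)
  simp only [eval_mul, eval_X]
  field_simp

/-! ### Singular points of equations whose coefficients are finite sums of poles. -/

theorem analyticAt_sum_div_pow_sub {ι : Type*} (s : Finset ι) (w a : ι → ℂ) (n : ℕ) {x : ℂ}
    (hx : ∀ i ∈ s, x ≠ w i) : AnalyticAt ℂ (fun z => ∑ i ∈ s, a i / (z - w i) ^ n) x := by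
  refine Finset.analyticAt_fun_sum _ fun i hi => ?_
  exact analyticAt_const.fun_div ((analyticAt_id.fun_sub analyticAt_const).fun_pow n)
    (pow_ne_zero n (sub_ne_zero.2 (hx i hi)))

theorem isOrdinaryPoint_of_poles {ι : Type*} [Fintype ι] {w a b c : ι → ℂ} {p q : ℂ → ℂ}
    (hp : ∀ z, p z = ∑ i, a i / (z - w i))
    (hq : ∀ z, q z = ∑ i, b i / (z - w i) ^ 2 + ∑ i, c i / (z - w i))
    {x : ℂ} (hx : ∀ i, x ≠ w i) : IsOrdinaryPoint p q x := by
  have h (a : ι → ℂ) (n : ℕ) := analyticAt_sum_div_pow_sub Finset.univ w a n (fun i _ => hx i)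
  refine ⟨p, q, ?_, ?_, Eventually.of_forall fun z => ⟨rfl, rfl⟩⟩
  · rw [funext hp]
    simpa using h a 1
  · rw [funext hq]
    simpa using (h b 2).fun_add (h c 1)

theorem hasRegularForm_of_poles {ι : Type*} [Fintype ι] [DecidableEq ι] {w a b c : ι → ℂ}
    {p q : ℂ → ℂ} (hw : Function.Injective w)
    (hp : ∀ z, p z = ∑ i, a i / (z - w i))
    (hq : ∀ z, q z = ∑ i, b i / (z - w i) ^ 2 + ∑ i, c i / (z - w i)) (i : ι) :
    HasRegularForm p q (w i) (a i) (b i) := by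
  have h (a : ι → ℂ) (n : ℕ) := analyticAt_sum_div_pow_sub (Finset.univ.erase i) w a n
    (x := w i) (fun j hj e => Finset.ne_of_mem_erase hj (hw e).symm)
  have hl : AnalyticAt ℂ (fun z : ℂ => z - w i) (w i) := analyticAt_id.fun_sub analyticAt_const
  refine ⟨fun z => a i + (z - w i) * ∑ j ∈ Finset.univ.erase i, a j / (z - w j) ^ 1,
    fun z => b i + c i * (z - w i) + (z - w i) ^ 2 *
      (∑ j ∈ Finset.univ.erase i, b j / (z - w j) ^ 2 + ∑ j ∈ Finset.univ.erase i, c j / (z - w j) ^ 1),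
    analyticAt_const.fun_add (hl.fun_mul (h a 1)),
    (analyticAt_const.fun_add (analyticAt_const.fun_mul hl)).fun_add
      ((hl.fun_pow 2).fun_mul ((h b 2).fun_add (h c 1))), by simp, by simp, ?_⟩
  filter_upwards [self_mem_nhdsWithin] with z hz
  have hz' : z - w i ≠ 0 := sub_ne_zero.2 hz
  simp only [hp, hq, pow_one]
  rw [← Finset.add_sum_erase _ (fun j => a j / (z - w j)) (Finset.mem_univ i),
    ← Finset.add_sum_erase _ (fun j => b j / (z - w j) ^ 2) (Finset.mem_univ i),
    ← Finset.add_sum_erase _ (fun j => c j / (z - w j)) (Finset.mem_univ i)]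
  constructor <;> field_simp
  ring

/-- Near `x`, the product `(z - x) p z` tends to `α`, whereas analyticity of `p` would make it tend
to `0`. -/
theorem not_isOrdinaryPoint_of_hasRegularForm {p q : ℂ → ℂ} {x α β : ℂ}
    (h : HasRegularForm p q x α β) (hα : α ≠ 0) : ¬ IsOrdinaryPoint p q x := by
  obtain ⟨f, g, hf, -, rfl, -, hfg⟩ := h
  rintro ⟨F, G, hF, -, hFG⟩
  have h₁ : Tendsto (fun z => (z - x) * F z) (𝓝[≠] x) (𝓝 0) := by
    have : ContinuousAt (fun z => (z - x) * F z) x :=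
      (continuousAt_id.sub continuousAt_const).mul hF.continuousAt
    simpa using this.tendsto.mono_left nhdsWithin_le_nhds
  have h₂ : Tendsto f (𝓝[≠] x) (𝓝 (f x)) := hf.continuousAt.tendsto.mono_left nhdsWithin_le_nhds
  refine hα (tendsto_nhds_unique (h₂.congr' ?_) h₁)
  filter_upwards [hfg, hFG, self_mem_nhdsWithin] with z hz hz' hne
  rw [← hz'.1, hz.1, mul_div_cancel₀ _ (sub_ne_zero.2 hne)]

/-- At infinity, `∑ c i = 0` removes the `1/z` term of `q`; then `q(1/t)` is `t²` times an analytic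
function, and `q(1/t)/t⁴` has a pole of order at most two. -/
theorem isFuchsian_of_poles {ι : Type*} [Fintype ι] [DecidableEq ι] {w a c : ι → ℂ}
    {p q : ℂ → ℂ} (hw : Function.Injective w) (hp : ∀ z, p z = ∑ i, a i / (z - w i))
    (hq : ∀ z, q z = ∑ i, c i / (z - w i)) (hc : ∑ i, c i = 0) : IsFuchsian p q := by
  have hq' : ∀ z, q z = ∑ i, (0 : ι → ℂ) i / (z - w i) ^ 2 + ∑ i, c i / (z - w i) := fun z => by
    simp [hq]
  constructor
  · intro z
    by_cases hz : ∃ i, z = w i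
    · obtain ⟨i, rfl⟩ := hz
      exact or_iff_not_imp_left.2 fun h => ⟨h, _, _, hasRegularForm_of_poles hw hp hq' i⟩
    · push Not at hz
      exact Or.inl (isOrdinaryPoint_of_poles hp hq' hz)
  · refine or_iff_not_imp_left.2 fun h => ⟨h, 2 - ∑ i, a i, ∑ i, c i * w i,
      fun t => 2 - ∑ i, a i / (1 - w i * t), fun t => ∑ i, c i * w i / (1 - w i * t),
      ?_, ?_, by simp, by simp, ?_⟩
    · refine analyticAt_const.fun_sub (Finset.analyticAt_fun_sum _ fun i _ => ?_)
      exact analyticAt_const.fun_div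
        (analyticAt_const.fun_sub (analyticAt_const.fun_mul analyticAt_id)) (by simp)
    · refine Finset.analyticAt_fun_sum _ fun i _ => ?_
      exact analyticAt_const.fun_div
        (analyticAt_const.fun_sub (analyticAt_const.fun_mul analyticAt_id)) (by simp)
    · have hne : ∀ᶠ t in 𝓝[≠] (0 : ℂ), ∀ i, 1 - w i * t ≠ 0 := by
        rw [eventually_all]
        intro i
        have : ContinuousAt (fun t : ℂ => 1 - w i * t) 0 := by fun_prop
        exact (this.eventually_ne (by simp)).filter_mono nhdsWithin_le_nhds
      filter_upwards [hne, self_mem_nhdsWithin] with t ht ht₀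
      have ht₀ : t ≠ 0 := ht₀
      have hinv : ∀ i, t⁻¹ - w i = (1 - w i * t) / t := fun i => by field_simp
      have e₁ : p t⁻¹ = t * ∑ i, a i / (1 - w i * t) := by
        rw [hp, Finset.mul_sum]
        refine Finset.sum_congr rfl fun i _ => ?_
        have := ht i
        rw [hinv]
        field_simp
      have e₂ : q t⁻¹ = t ^ 2 * ∑ i, c i * w i / (1 - w i * t) := by
        -- Subtracting this zero termwise turns `c t / (1 - w t)` into `c w t² / (1 - w t)`, which
        -- supplies the second factor `t`.
        have : q t⁻¹ = q t⁻¹ - t * ∑ i, c i := by rw [hc]; ring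
        rw [this, hq, Finset.mul_sum, Finset.mul_sum, ← Finset.sum_sub_distrib]
        refine Finset.sum_congr rfl fun i _ => ?_
        have := ht i
        rw [hinv]
        field_simp
        ring
      rw [e₁, e₂, sub_zero]
      constructor <;> field_simp

/-! ### Partial fractions of the coefficients of the radial equation. -/

namespace KNdS

open Polynomial in
/-- `Δ_r` as a polynomial. -/
noncomputable def deltaPoly (P : KNdS) : ℂ[X] :=
  (1 - C (P.Λ / 3 : ℂ) * X ^ 2) * (X ^ 2 + C (P.a ^ 2 : ℂ)) - C (2 * P.M : ℂ) * X + C (P.e ^ 2 : ℂ)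

open Polynomial in
/-- `K` as a polynomial. -/
noncomputable def kPoly (P : KNdS) : ℂ[X] :=
  C P.Xi * ((X ^ 2 + C (P.a ^ 2 : ℂ)) * C P.ω - C (P.m * P.a : ℂ)) + C (P.e * P.q : ℂ) * X

open Polynomial in
/-- The part of `-radialC` which is a polynomial. -/
noncomputable def massPoly (P : KNdS) : ℂ[X] :=
  C (2 * Complex.I * P.ω * P.Xi) * X + C (Complex.I * P.e * P.q) + C (P.μ ^ 2 : ℂ) * X ^ 2
    + C (P.lam ^ 2)

theorem Delta_eq (P : KNdS) : P.Delta = fun r => P.deltaPoly.eval r := by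
  funext r; simp [Delta, deltaPoly]

theorem deriv_Delta (P : KNdS) : deriv P.Delta = fun r => P.deltaPoly.derivative.eval r := by
  rw [Delta_eq]; funext r; exact Polynomial.deriv _

theorem deriv_deriv_Delta (P : KNdS) :
    deriv (deriv P.Delta) = fun r => P.deltaPoly.derivative.derivative.eval r := by
  rw [deriv_Delta]; funext r; exact Polynomial.deriv _

theorem K_eq (P : KNdS) : P.K = fun r => P.kPoly.eval r := by
  funext r; simp [K, kPoly]

theorem deriv_K (P : KNdS) : deriv P.K = fun r => P.kPoly.derivative.eval r := by
  rw [K_eq]; funext r; exact Polynomial.deriv _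

theorem natDegree_deltaPoly_le (P : KNdS) : P.deltaPoly.natDegree ≤ 4 := by
  unfold deltaPoly; compute_degree

theorem coeff_deltaPoly_four (P : KNdS) : P.deltaPoly.coeff 4 = -P.Λ / 3 := by
  have : P.deltaPoly = Polynomial.C (-P.Λ / 3 : ℂ) * Polynomial.X ^ 4
      + (Polynomial.C (1 - P.Λ / 3 * P.a ^ 2 : ℂ) * Polynomial.X ^ 2
      + Polynomial.C (-2 * P.M : ℂ) * Polynomial.X ^ 1 + Polynomial.C (P.a ^ 2 + P.e ^ 2 : ℂ)) := by
    apply Polynomial.funext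
    intro r
    simp [deltaPoly]
    ring
  rw [this]
  simp only [Polynomial.coeff_add, Polynomial.coeff_C_mul, Polynomial.coeff_X_pow,
    Polynomial.coeff_C]
  norm_num

theorem natDegree_kPoly_le (P : KNdS) : P.kPoly.natDegree ≤ 2 := by
  unfold kPoly; compute_degree

theorem natDegree_massPoly_le (P : KNdS) : P.massPoly.natDegree ≤ 2 := by
  unfold massPoly; compute_degree

section Radial

variable {P : KNdS} {v : Fin 4 → ℂ}

-- Both sides have degree 4 and leading coefficient `-Λ/3`, so their difference has degree below 4;
-- it vanishes at four distinct points.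
open Polynomial in
theorem deltaPoly_eq_prod (hΛ : P.Λ ≠ 0) (hroot : ∀ i, P.Delta (v i) = 0)
    (hv : Function.Injective v) :
    P.deltaPoly = C (-P.Λ / 3 : ℂ) * ∏ i, (X - C (v i)) := by
  have hk : (-P.Λ / 3 : ℂ) ≠ 0 := by simpa using hΛ
  have hdeg : P.deltaPoly.natDegree = 4 :=
    le_antisymm P.natDegree_deltaPoly_le (le_natDegree_of_ne_zero (by
      rw [coeff_deltaPoly_four]; exact hk))
  have h0 : P.deltaPoly ≠ 0 := by
    rintro h
    simp [h] at hdeg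
  have hd : P.deltaPoly.degree = 4 := by rw [degree_eq_natDegree h0, hdeg]; rfl
  refine eq_of_degree_sub_lt_of_eval_index_eq (Finset.univ : Finset (Fin 4)) hv.injOn ?_ fun i _ => ?_
  · refine (degree_sub_lt_left ?_ h0 ?_).trans_le (by rw [hd]; simp)
    · rw [hd]; simp [degree_prod, degree_C hk]
    · rw [leadingCoeff, hdeg, coeff_deltaPoly_four]
      simp [leadingCoeff_prod]
  · have h := hroot i
    rw [Delta_eq] at h
    simp only [eval_mul, eval_prod, eval_sub, eval_X, eval_C]
    rw [show P.deltaPoly.eval (v i) = 0 from h, Finset.prod_eq_zero (Finset.mem_univ i) (by simp), mul_zero]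

theorem Delta_eq_prod (hΛ : P.Λ ≠ 0) (hroot : ∀ i, P.Delta (v i) = 0)
    (hv : Function.Injective v) (r : ℂ) : P.Delta r = -P.Λ / 3 * ∏ i, (r - v i) := by
  rw [Delta_eq, deltaPoly_eq_prod hΛ hroot hv]
  simp [Polynomial.eval_prod]

theorem Delta_ne_zero (hΛ : P.Λ ≠ 0) (hroot : ∀ i, P.Delta (v i) = 0)
    (hv : Function.Injective v) {r : ℂ} (hr : ∀ i, r ≠ v i) : P.Delta r ≠ 0 := by
  rw [Delta_eq_prod hΛ hroot hv]
  refine mul_ne_zero (by simpa using hΛ) (Finset.prod_ne_zero_iff.2 fun i _ => ?_)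
  exact sub_ne_zero.2 (hr i)

theorem deriv_Delta_ne_zero (hΛ : P.Λ ≠ 0) (hroot : ∀ i, P.Delta (v i) = 0)
    (hv : Function.Injective v) (i : Fin 4) : deriv P.Delta (v i) ≠ 0 := by
  rw [deriv_Delta]
  exact derivative_eval_ne_zero_of_simple_roots hv (by simpa using hΛ)
    (deltaPoly_eq_prod hΛ hroot hv) i

theorem lam_add_eq (hμ : P.μ ≠ 0) (r : ℂ) :
    P.lam + Complex.I * P.μ * r = Complex.I * P.μ * (r - P.r₅) := by
  have : (P.μ : ℂ) ≠ 0 := by simpa using hμ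
  unfold r₅
  field_simp
  linear_combination P.lam * Complex.I_sq

theorem radialB_div_Delta (hΛ : P.Λ ≠ 0) (hμ : P.μ ≠ 0) (hroot : ∀ i, P.Delta (v i) = 0)
    (hv : Function.Injective v) {r : ℂ} (hr : ∀ i, r ≠ v i) :
    P.radialB r / P.Delta r = preB v P.r₅ r := by
  have hD := Delta_ne_zero hΛ hroot hv hr
  have hμ' : (P.μ : ℂ) ≠ 0 := by simpa using hμ
  have hlog : deriv P.Delta r / P.Delta r = ∑ i, 1 / (r - v i) := by
    have h := eval_div_eq_partial_fractions (T := P.deltaPoly.derivative) hv (by simpa using hΛ)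
      (deltaPoly_eq_prod hΛ hroot hv) ?_ hr
    · rw [deriv_Delta, Delta_eq]
      refine h.trans (Finset.sum_congr rfl fun i _ => ?_)
      have := deriv_Delta_ne_zero hΛ hroot hv i
      rw [deriv_Delta] at this
      rw [div_self this]
    · refine (Polynomial.degree_le_natDegree.trans (Nat.cast_le.2
        (Polynomial.natDegree_derivative_le _))).trans_lt (Nat.cast_lt.2 ?_)
      have := P.natDegree_deltaPoly_le
      simp only [Fintype.card_fin]
      omega
  rw [preB, ← hlog, radialB, lam_add_eq hμ]
  -- The point `r = r₅` is not excluded here; there both terms with denominator `r - r₅` take the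
  -- value `0` of division by zero.
  by_cases h : r - P.r₅ = 0
  · simp [h]
    field_simp
  · field_simp

theorem K_div_Delta (hΛ : P.Λ ≠ 0) (hroot : ∀ i, P.Delta (v i) = 0)
    (hv : Function.Injective v) {r : ℂ} (hr : ∀ i, r ≠ v i) :
    P.K r / P.Delta r = ∑ i, P.K (v i) / deriv P.Delta (v i) / (r - v i) := by
  rw [K_eq, deriv_Delta, Delta_eq]
  refine eval_div_eq_partial_fractions hv (by simpa using hΛ) (deltaPoly_eq_prod hΛ hroot hv) ?_ hr
  refine Polynomial.degree_le_natDegree.trans_lt (Nat.cast_lt.2 ?_)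
  have := P.natDegree_kPoly_le
  simp only [Fintype.card_fin]
  omega

open Polynomial in
/-- The numerator of the part of `radialC / Δ_r` with double poles. -/
noncomputable def doublePoly (P : KNdS) : ℂ[X] :=
  P.kPoly ^ 2 + C (Complex.I / 2) * P.kPoly * P.deltaPoly.derivative

theorem natDegree_doublePoly_le (P : KNdS) : P.doublePoly.natDegree ≤ 5 := by
  have h₁ := P.natDegree_kPoly_le
  have h₂ := P.natDegree_deltaPoly_le
  have h₃ := Polynomial.natDegree_derivative_le P.deltaPoly
  unfold doublePoly
  refine Polynomial.natDegree_add_le_of_degree_le ?_ ?_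
  · exact Polynomial.natDegree_pow_le.trans (by omega)
  · refine Polynomial.natDegree_mul_le.trans ?_
    have := Polynomial.natDegree_C_mul_le (Complex.I / 2) P.kPoly
    omega

/-- The residue at `v i` of the part of `radialC / Δ_r` with double poles. -/
noncomputable def doubleResidue (P : KNdS) (r : ℂ) : ℂ :=
  (2 * P.K r * deriv P.K r * deriv P.Delta r - P.K r ^ 2 * deriv (deriv P.Delta) r)
    / deriv P.Delta r ^ 3 + Complex.I * deriv P.K r / (2 * deriv P.Delta r)

/-- The two contributions `± (i/2) K Δ' Δ''` cancel, which is why `Δ''` survives in the residue only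
next to `K²`. -/
theorem doublePoly_residue {r : ℂ} (hr : deriv P.Delta r ≠ 0) :
    (P.doublePoly.derivative.eval r * P.deltaPoly.derivative.eval r
      - P.doublePoly.eval r * P.deltaPoly.derivative.derivative.eval r)
        / P.deltaPoly.derivative.eval r ^ 3 = P.doubleResidue r := by
  rw [doubleResidue, deriv_deriv_Delta, deriv_K, K_eq]
  rw [deriv_Delta] at hr ⊢
  simp only [doublePoly, Polynomial.derivative_add, Polynomial.derivative_mul,
    Polynomial.derivative_pow, Polynomial.derivative_C, Polynomial.eval_add, Polynomial.eval_mul,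
    Polynomial.eval_pow, Polynomial.eval_C, Polynomial.eval_zero]
  field_simp
  simp
  ring

theorem radialC_double_part (hΛ : P.Λ ≠ 0) (hroot : ∀ i, P.Delta (v i) = 0)
    (hv : Function.Injective v) {r : ℂ} (hr : ∀ i, r ≠ v i) :
    (P.K r ^ 2 + Complex.I * P.K r / 2 * deriv P.Delta r) / P.Delta r ^ 2 =
      ∑ i, P.Q (v i) / (r - v i) ^ 2 + ∑ i, P.doubleResidue (v i) / (r - v i) := by
  have h := eval_div_sq_eq_partial_fractions (N := P.doublePoly) hv (by simpa using hΛ)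
    (deltaPoly_eq_prod hΛ hroot hv) ?_ hr
  · have hne := deriv_Delta_ne_zero hΛ hroot hv
    simp only [fun i => doublePoly_residue (hne i)] at h
    convert h using 2
    · simp only [doublePoly, K_eq, deriv_Delta, Polynomial.eval_add, Polynomial.eval_mul,
        Polynomial.eval_pow, Polynomial.eval_C]
      ring
    · rw [Delta_eq]
    · refine Finset.sum_congr rfl fun i _ => ?_
      have := hne i
      rw [deriv_Delta] at this
      simp only [Q, doublePoly, K_eq, deriv_Delta, Polynomial.eval_add, Polynomial.eval_mul,
        Polynomial.eval_pow, Polynomial.eval_C]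
      field_simp
  · refine Polynomial.degree_le_natDegree.trans_lt (Nat.cast_lt.2 ?_)
    have := P.natDegree_doublePoly_le
    simp only [Fintype.card_fin]
    omega

/-- The numerator has degree at most 5, so even `X` times it stays below the degree 8 of `Δ²`. -/
theorem sum_doubleResidue (hΛ : P.Λ ≠ 0) (hroot : ∀ i, P.Delta (v i) = 0)
    (hv : Function.Injective v) : ∑ i, P.doubleResidue (v i) = 0 := by
  have h := sum_residues_div_sq_eq_zero (N := P.doublePoly) hv (by simpa using hΛ)
    (deltaPoly_eq_prod hΛ hroot hv) ?_
  · simpa only [fun i => doublePoly_residue (deriv_Delta_ne_zero hΛ hroot hv i)] using h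
  · refine Polynomial.degree_le_natDegree.trans_lt (Nat.cast_lt.2 ?_)
    have h₁ := P.natDegree_doublePoly_le
    have h₂ := Polynomial.natDegree_mul_le (p := Polynomial.X) (q := P.doublePoly)
    rw [Polynomial.natDegree_X] at h₂
    simp only [Fintype.card_fin]
    omega

theorem massPoly_div_Delta (hΛ : P.Λ ≠ 0) (hroot : ∀ i, P.Delta (v i) = 0)
    (hv : Function.Injective v) {r : ℂ} (hr : ∀ i, r ≠ v i) :
    P.massPoly.eval r / P.Delta r =
      ∑ i, P.massPoly.eval (v i) / deriv P.Delta (v i) / (r - v i) := by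
  rw [deriv_Delta, Delta_eq]
  refine eval_div_eq_partial_fractions hv (by simpa using hΛ) (deltaPoly_eq_prod hΛ hroot hv) ?_ hr
  refine Polynomial.degree_le_natDegree.trans_lt (Nat.cast_lt.2 ?_)
  have := P.natDegree_massPoly_le
  simp only [Fintype.card_fin]
  omega

theorem sum_massPoly (hΛ : P.Λ ≠ 0) (hroot : ∀ i, P.Delta (v i) = 0)
    (hv : Function.Injective v) : ∑ i, P.massPoly.eval (v i) / deriv P.Delta (v i) = 0 := by
  rw [deriv_Delta]
  refine sum_residues_div_eq_zero hv (by simpa using hΛ) (deltaPoly_eq_prod hΛ hroot hv) ?_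
  refine Polynomial.degree_le_natDegree.trans_lt (Nat.cast_lt.2 ?_)
  have h₁ := P.natDegree_massPoly_le
  have h₂ := Polynomial.natDegree_mul_le (p := Polynomial.X) (q := P.massPoly)
  rw [Polynomial.natDegree_X] at h₂
  simp only [Fintype.card_fin]
  omega

theorem mass_mul_K_div (hμ : P.μ ≠ 0) {r : ℂ} (hr : r ≠ P.r₅) :
    P.μ * P.K r / (P.lam + Complex.I * P.μ * r) = -Complex.I * (P.K r / (r - P.r₅)) := by
  have h₁ : (P.μ : ℂ) ≠ 0 := by simpa using hμ
  have h₂ := sub_ne_zero.2 hr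
  have := Complex.I_ne_zero
  rw [lam_add_eq hμ]
  field_simp
  linear_combination P.K r * Complex.I_sq

/-- Splits `L` into its three sources: the double-pole part, the mass polynomial, and the term with
the extra pole at `r₅`. Each can then be summed or expanded separately. -/
theorem L_eq (hμ : P.μ ≠ 0) (rp rm : ℝ) {r : ℂ} (hr : r ≠ P.r₅) :
    P.L rp rm r = (rm - rp) * (P.doubleResidue r - P.massPoly.eval r / deriv P.Delta r
      + Complex.I * (P.K r / deriv P.Delta r / (r - P.r₅))) := by
  rw [L, mass_mul_K_div hμ hr, doubleResidue]
  simp only [massPoly, Polynomial.eval_add, Polynomial.eval_mul, Polynomial.eval_pow,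
    Polynomial.eval_C, Polynomial.eval_X]
  ring

/-- The first two sources have residue sum zero by degree. For the third, the expansion of `K/Δ`
evaluated at `r₅` shows that `L₅` is minus the sum over the four radii. -/
theorem sum_L (hΛ : P.Λ ≠ 0) (hμ : P.μ ≠ 0) (hroot : ∀ i, P.Delta (v i) = 0)
    (hv : Function.Injective v) (h₅ : ∀ i, P.r₅ ≠ v i) (rp rm : ℝ) :
    ∑ i, P.L rp rm (v i) + P.L₅ rp rm = 0 := by
  simp only [fun i => L_eq hμ rp rm (h₅ i).symm]
  rw [L₅, ← Finset.mul_sum, Finset.sum_add_distrib, Finset.sum_sub_distrib, sum_massPoly hΛ hroot hv,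
    sum_doubleResidue hΛ hroot hv, ← Finset.mul_sum, mul_div_assoc, K_div_Delta hΛ hroot hv h₅]
  have : ∑ i, P.K (v i) / deriv P.Delta (v i) / (P.r₅ - v i) =
      -∑ i, P.K (v i) / deriv P.Delta (v i) / (v i - P.r₅) := by
    rw [← Finset.sum_neg_distrib]
    refine Finset.sum_congr rfl fun i _ => ?_
    rw [← neg_sub (v i), div_neg]
  rw [this]
  ring

theorem radialC_div_Delta (hΛ : P.Λ ≠ 0) (hμ : P.μ ≠ 0) (hroot : ∀ i, P.Delta (v i) = 0)
    (hv : Function.Injective v) (h₅ : ∀ i, P.r₅ ≠ v i) {r : ℂ} (hr : ∀ i, r ≠ v i)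
    (hr₅ : r ≠ P.r₅) (rp rm : ℝ) :
    (rm - rp) * (P.radialC r / P.Delta r) =
      (rm - rp) * ∑ i, P.Q (v i) / (r - v i) ^ 2 + ∑ i, P.L rp rm (v i) / (r - v i)
        + P.L₅ rp rm / (r - P.r₅) := by
  have hD := Delta_ne_zero hΛ hroot hv hr
  have hr' := sub_ne_zero.2 hr₅
  have e : P.radialC r / P.Delta r =
      (P.K r ^ 2 + Complex.I * P.K r / 2 * deriv P.Delta r) / P.Delta r ^ 2
        - P.massPoly.eval r / P.Delta r + Complex.I / (r - P.r₅) * (P.K r / P.Delta r) := by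
    rw [radialC, mass_mul_K_div hμ hr₅]
    simp only [massPoly, Polynomial.eval_add, Polynomial.eval_mul, Polynomial.eval_pow,
      Polynomial.eval_C, Polynomial.eval_X]
    field_simp
    ring
  have e₅ : P.L₅ rp rm = (rm - rp) * (Complex.I * (P.K P.r₅ / P.Delta P.r₅)) := by
    rw [L₅]; ring
  rw [e, radialC_double_part hΛ hroot hv hr, massPoly_div_Delta hΛ hroot hv hr, e₅,
    K_div_Delta hΛ hroot hv hr, K_div_Delta hΛ hroot hv h₅]
  simp only [fun i => L_eq hμ rp rm (h₅ i).symm]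
  -- Termwise splitting of `1/((r - r₅)(r - v i))`; the parts with pole `r₅` add up to the expansion
  -- of `K/Δ` at `r₅`, which gives `L₅`.
  have key : Complex.I / (r - P.r₅) * ∑ i, P.K (v i) / deriv P.Delta (v i) / (r - v i) =
      ∑ i, Complex.I * (P.K (v i) / deriv P.Delta (v i) / (v i - P.r₅)) / (r - v i)
      + Complex.I * (∑ i, P.K (v i) / deriv P.Delta (v i) / (P.r₅ - v i)) / (r - P.r₅) := by
    rw [Finset.mul_sum, Finset.mul_sum, Finset.sum_div, ← Finset.sum_add_distrib]
    refine Finset.sum_congr rfl fun i _ => ?_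
    have h1 := sub_ne_zero.2 (hr i)
    have h2 := sub_ne_zero.2 (h₅ i)
    rw [← neg_sub P.r₅ (v i)]
    field_simp
    ring
  rw [key]
  simp only [mul_add, mul_sub, add_div, sub_div, Finset.sum_add_distrib, Finset.sum_sub_distrib,
    Finset.mul_sum, Finset.sum_div, mul_div_assoc]
  ring

end Radial

end KNdS

/-! ### Rational identities behind the F-homotopic transformation. -/

namespace KNdS

theorem preB_affine {v z : Fin 4 → ℂ} {r₅ z₅ b c : ℂ} (hv : ∀ i, v i = b + z i * c)
    (hr₅ : r₅ = b + z₅ * c) (hc : c ≠ 0) (x : ℂ) :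
    c * preB v r₅ (b + x * c) = preB z z₅ x := by
  have e : ∀ y : ℂ, c * (1 / (b + x * c - (b + y * c))) = 1 / (x - y) := fun y => by
    rw [show b + x * c - (b + y * c) = c * (x - y) by ring, ← mul_div_assoc, mul_one,
      div_mul_eq_div_div, div_self hc]
  simp only [preB, hv, hr₅, ← e, ← Finset.mul_sum]
  ring

theorem finalB_eq (z ν : Fin 4 → ℂ) (z₅ x : ℂ) :
    finalB z ν z₅ x = preB z z₅ x + 2 * ∑ i, ν i / (x - z i) := by
  simp only [finalB, preB, Fin.sum_univ_four, div_eq_mul_inv, mul_inv]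
  ring

/-- The diagonal term may be included because its denominator is `0`, so the quotient is `0`; the
full sum is easier to expand. -/
theorem L'_eq (z ν L : Fin 4 → ℂ) (z₅ : ℂ) (i : Fin 4) :
    L' z ν L z₅ i = L i + ∑ j, (4 * ν i * ν j + ν i + ν j) / (2 * (z i - z j))
      - ν i / (z i - z₅) := by
  rw [L', Finset.sum_erase _ (by simp)]

/-- The right-hand side is `q + p s + s² + s'`. The indicial equations `hν` cancel its double poles,
and every product of two distinct simple poles is split by `pf`. -/
theorem finalC_eq {z ν Q L : Fin 4 → ℂ} {z₅ L₅ : ℂ} (hz : Function.Injective z)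
    (hz₅ : ∀ i, z₅ ≠ z i) (hν : ∀ i, ν i * (ν i - 1) + 1 / 2 * ν i + Q i = 0)
    {x : ℂ} (hx : ∀ i, x ≠ z i) (hx₅ : x ≠ z₅) :
    finalC z ν L z₅ L₅ x = preC z Q L z₅ L₅ x + preB z z₅ x * ∑ i, ν i / (x - z i)
      + (∑ i, ν i / (x - z i)) ^ 2 + -∑ i, ν i / (x - z i) ^ 2 := by
  have pf : ∀ a b : ℂ, x ≠ a → x ≠ b → a ≠ b →
      (x - a)⁻¹ * (x - b)⁻¹ = (a - b)⁻¹ * ((x - a)⁻¹ - (x - b)⁻¹) := fun a b ha hb hab => by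
    have h1 := sub_ne_zero.2 ha
    have h2 := sub_ne_zero.2 hb
    have h3 := sub_ne_zero.2 hab
    field_simp
    ring
  have h (i j : Fin 4) (hij : i ≠ j) := pf _ _ (hx i) (hx j) (fun e => hij (hz e))
  have h5 (i : Fin 4) := pf _ _ (hx i) hx₅ (hz₅ i).symm
  have n (a b : ℂ) : (a - b)⁻¹ = -(b - a)⁻¹ := by rw [← neg_sub, inv_neg]
  simp only [finalC, L'_eq, L₅', preC, preB, Fin.sum_univ_four, sub_self, div_eq_mul_inv, mul_inv,
    one_mul]
  -- Each inverse difference gets one orientation, so that the final identity is polynomial in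
  -- independent inverses.
  rw [n (z 1) (z 0), n (z 2) (z 0), n (z 3) (z 0), n (z 2) (z 1), n (z 3) (z 1), n (z 3) (z 2),
    n z₅ (z 0), n z₅ (z 1), n z₅ (z 2), n z₅ (z 3)]
  have h01 := h 0 1 (by decide)
  have h02 := h 0 2 (by decide)
  have h03 := h 0 3 (by decide)
  have h12 := h 1 2 (by decide)
  have h13 := h 1 3 (by decide)
  have h23 := h 2 3 (by decide)
  have s (i : Fin 4) : ((x - z i) ^ 2)⁻¹ = (x - z i)⁻¹ ^ 2 := inv_pow _ _ |>.symm
  simp only [s, inv_zero]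
  linear_combination
    -((4 * ν 0 * ν 1 + ν 0 + ν 1) / 2 * h01 + (4 * ν 0 * ν 2 + ν 0 + ν 2) / 2 * h02
      + (4 * ν 0 * ν 3 + ν 0 + ν 3) / 2 * h03 + (4 * ν 1 * ν 2 + ν 1 + ν 2) / 2 * h12
      + (4 * ν 1 * ν 3 + ν 1 + ν 3) / 2 * h13 + (4 * ν 2 * ν 3 + ν 2 + ν 3) / 2 * h23)
    + ν 0 * h5 0 + ν 1 * h5 1 + ν 2 * h5 2 + ν 3 * h5 3
    - (x - z 0)⁻¹ ^ 2 * hν 0 - (x - z 1)⁻¹ ^ 2 * hν 1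
    - (x - z 2)⁻¹ ^ 2 * hν 2 - (x - z 3)⁻¹ ^ 2 * hν 3

/-- The corrections are antisymmetric in the two points involved, including the pairs with `z₅`, and
cancel in the sum. -/
theorem sum_L' (z ν L : Fin 4 → ℂ) (z₅ L₅ : ℂ) :
    ∑ i, L' z ν L z₅ i + L₅' z ν z₅ L₅ = ∑ i, L i + L₅ := by
  have n (a b : ℂ) : (a - b)⁻¹ = -(b - a)⁻¹ := by rw [← neg_sub, inv_neg]
  simp only [L'_eq, L₅', Fin.sum_univ_four, sub_self, mul_zero, div_eq_mul_inv, mul_inv,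
    inv_zero]
  rw [n (z 1) (z 0), n (z 2) (z 0), n (z 3) (z 0), n (z 2) (z 1), n (z 3) (z 1), n (z 3) (z 2),
    n z₅ (z 0), n z₅ (z 1), n z₅ (z 2), n z₅ (z 3)]
  ring

/-- The five values `f 0, …, f 3, y`. -/
def fivePoints (f : Fin 4 → ℂ) (y : ℂ) (o : Option (Fin 4)) : ℂ := o.elim y f

theorem fivePoints_injective {z : Fin 4 → ℂ} {z₅ : ℂ} (hz : Function.Injective z)
    (hz₅ : ∀ i, z₅ ≠ z i) : Function.Injective (fivePoints z z₅) := by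
  rintro (_ | i) (_ | j) h
  · rfl
  · exact absurd h (hz₅ j)
  · exact absurd h.symm (hz₅ i)
  · exact congrArg some (hz h)

theorem preB_poles (z : Fin 4 → ℂ) (z₅ x : ℂ) :
    preB z z₅ x = ∑ o, fivePoints (fun _ => 1 / 2) (-1) o / (x - fivePoints z z₅ o) := by
  simp only [preB, fivePoints, Fintype.sum_option, Option.elim, Fin.sum_univ_four]
  ring

theorem preC_poles (z Q L : Fin 4 → ℂ) (z₅ L₅ x : ℂ) :
    preC z Q L z₅ L₅ x = ∑ o, fivePoints Q 0 o / (x - fivePoints z z₅ o) ^ 2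
      + ∑ o, fivePoints L L₅ o / (x - fivePoints z z₅ o) := by
  simp only [preC, fivePoints, Fintype.sum_option, Option.elim]
  ring

theorem finalB_poles (z ν : Fin 4 → ℂ) (z₅ x : ℂ) :
    finalB z ν z₅ x =
      ∑ o, fivePoints (fun i => (1 + 4 * ν i) / 2) (-1) o / (x - fivePoints z z₅ o) := by
  simp only [finalB, fivePoints, Fintype.sum_option, Option.elim, Fin.sum_univ_four,
    div_eq_mul_inv, mul_inv]
  ring

theorem finalC_poles (z ν L : Fin 4 → ℂ) (z₅ L₅ x : ℂ) :
    finalC z ν L z₅ L₅ x =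
      ∑ o, fivePoints (L' z ν L z₅) (L₅' z ν z₅ L₅) o / (x - fivePoints z z₅ o) := by
  simp only [finalC, fivePoints, Fintype.sum_option, Option.elim]
  ring

theorem finalC_poles' (z ν L : Fin 4 → ℂ) (z₅ L₅ x : ℂ) :
    finalC z ν L z₅ L₅ x = ∑ o, fivePoints 0 0 o / (x - fivePoints z z₅ o) ^ 2
      + ∑ o, fivePoints (L' z ν L z₅) (L₅' z ν z₅ L₅) o / (x - fivePoints z z₅ o) := by
  simp [finalC_poles, fivePoints, Fintype.sum_option]

theorem deriv_Delta_apply (P : KNdS) (r : ℂ) :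
    deriv P.Delta r = -4 * P.Λ / 3 * r ^ 3 + 2 * (1 - P.Λ / 3 * P.a ^ 2) * r - 2 * P.M := by
  rw [deriv_Delta]
  simp [deltaPoly, Polynomial.derivative_pow]
  ring

/-- For real energy, the value `-1 / 4` is not an exponent at a real radius. -/
theorem exponent_ne_neg_quarter {P : KNdS} {r ν : ℂ} (hω : P.ω.im = 0) (hr : r.im = 0)
    (hν : ν * (ν - 1) + 1 / 2 * ν + P.Q r = 0) : ν ≠ -1 / 4 := by
  rintro rfl
  lift P.ω to ℝ using hω with w hw
  lift r to ℝ using hr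
  have hK : P.K r = (((1 + P.a ^ 2 * P.Λ / 3) * ((r ^ 2 + P.a ^ 2) * w - P.m * P.a)
      + P.e * P.q * r : ℝ) : ℂ) := by
    simp [K, Xi, ← hw]
  have hD : deriv P.Delta r = ((-4 * P.Λ / 3 * r ^ 3 + 2 * (1 - P.Λ / 3 * P.a ^ 2) * r - 2 * P.M : ℝ)
      : ℂ) := by
    simp [deriv_Delta_apply]
  -- With `t = K/Δ'` real and `ν = -1/4`, the real part of the indicial equation is `3/16 + t² = 0`.
  obtain ⟨t, ht⟩ : ∃ t : ℝ, P.K r / deriv P.Delta r = t := by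
    rw [hK, hD, ← Complex.ofReal_div]
    exact ⟨_, rfl⟩
  have hQ : P.Q r = (t : ℂ) ^ 2 + Complex.I * t / 2 := by
    rw [Q, ← ht]; ring
  rw [hQ] at hν
  have him := congrArg Complex.im hν
  have hre := congrArg Complex.re hν
  norm_num [pow_two] at him hre
  nlinarith

end KNdS

/-! ### The two equivalences and the final theorem. -/

theorem isSolutionOn_radial_iff {P : KNdS} (hΛ : P.Λ ≠ 0) (hμ : P.μ ≠ 0) {rp rm : ℝ}
    {v z : Fin 4 → ℂ} {z₅ : ℂ} (hroot : ∀ i, P.Delta (v i) = 0) (hv : Function.Injective v)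
    (h₅ : ∀ i, P.r₅ ≠ v i) (hc : (rm : ℂ) - rp ≠ 0) (hz : ∀ i, v i = rp + z i * (rm - rp))
    (hz₅ : P.r₅ = rp + z₅ * (rm - rp))
    {𝕜 : Type*} [RCLike 𝕜] [NormedAlgebra 𝕜 ℂ] [IsScalarTower ℝ 𝕜 ℂ] {U : Set 𝕜} (hU : IsOpen U)
    (hUz : ∀ x ∈ U, (∀ i, algebraMap 𝕜 ℂ x ≠ z i) ∧ algebraMap 𝕜 ℂ x ≠ z₅) {R Rz : 𝕜 → ℂ}
    (hR : ∀ x ∈ U,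
      Rz x = R (algebraMap ℝ 𝕜 rp + x * (algebraMap ℝ 𝕜 rm - algebraMap ℝ 𝕜 rp))) :
    IsSolutionOn P.Delta P.radialB P.radialC
        ((fun x => algebraMap ℝ 𝕜 rp + x * (algebraMap ℝ 𝕜 rm - algebraMap ℝ 𝕜 rp)) '' U) R ↔
      IsSolutionOn 1 (KNdS.preB z z₅)
        (KNdS.preC z (fun i => P.Q (v i)) (fun i => P.L rp rm (v i)) z₅ (P.L₅ rp rm)) U Rz := by
  have hmap : ∀ r : ℝ, algebraMap 𝕜 ℂ (algebraMap ℝ 𝕜 r) = (r : ℂ) := fun r =>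
    (IsScalarTower.algebraMap_apply ℝ 𝕜 ℂ r).symm
  have hcmap : algebraMap 𝕜 ℂ (algebraMap ℝ 𝕜 rm - algebraMap ℝ 𝕜 rp) = rm - rp := by
    rw [map_sub, hmap, hmap]
  have hgmap : ∀ x : 𝕜, algebraMap 𝕜 ℂ
      (algebraMap ℝ 𝕜 rp + x * (algebraMap ℝ 𝕜 rm - algebraMap ℝ 𝕜 rp)) =
      rp + algebraMap 𝕜 ℂ x * (rm - rp) := fun x => by
    rw [map_add, map_mul, hcmap, hmap]
  have hne : ∀ {x y : ℂ}, x ≠ y → (rp : ℂ) + x * (rm - rp) ≠ rp + y * (rm - rp) := fun h e =>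
    h (mul_right_cancel₀ hc (add_left_cancel e))
  have hr : ∀ x ∈ U, ∀ i, (rp : ℂ) + algebraMap 𝕜 ℂ x * (rm - rp) ≠ v i := fun x hx i => by
    rw [hz i]; exact hne ((hUz x hx).1 i)
  have hr₅ : ∀ x ∈ U, (rp : ℂ) + algebraMap 𝕜 ℂ x * (rm - rp) ≠ P.r₅ := fun x hx => by
    rw [hz₅]; exact hne (hUz x hx).2
  have hD : ∀ x ∈ U, P.Delta (rp + algebraMap 𝕜 ℂ x * (rm - rp)) ≠ 0 := fun x hx =>
    KNdS.Delta_ne_zero hΛ hroot hv (hr x hx)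
  refine isSolutionOn_image_affine_iff ?_ hU hR ?_ ?_ ?_
  · intro h
    rw [h, map_zero] at hcmap
    exact hc hcmap.symm
  · intro x hx
    rw [hgmap]
    exact hD x hx
  · intro x hx
    rw [hgmap, hcmap, ← KNdS.preB_affine hz hz₅ hc,
      ← KNdS.radialB_div_Delta hΛ hμ hroot hv (hr x hx)]
    rw [mul_left_comm, mul_div_cancel₀ _ (hD x hx)]
  · intro x hx
    rw [hgmap, hcmap]
    have h := KNdS.radialC_div_Delta hΛ hμ hroot hv h₅ (hr x hx) (hr₅ x hx) rp rm
    have h' : ((rm : ℂ) - rp) ^ 2 * P.radialC (rp + algebraMap 𝕜 ℂ x * (rm - rp)) =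
        P.Delta (rp + algebraMap 𝕜 ℂ x * (rm - rp)) * ((rm - rp) * ((rm - rp) *
        (P.radialC (rp + algebraMap 𝕜 ℂ x * (rm - rp)) /
          P.Delta (rp + algebraMap 𝕜 ℂ x * (rm - rp))))) := by
      rw [mul_left_comm, mul_left_comm (P.Delta _), mul_div_cancel₀ _ (hD x hx)]
      ring
    rw [h', h]
    congr 1
    have e : ∀ y : ℂ, (rp : ℂ) + algebraMap 𝕜 ℂ x * (rm - rp) - (rp + y * (rm - rp)) =
      (rm - rp) * (algebraMap 𝕜 ℂ x - y) := fun y => by ring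
    rw [KNdS.preC, mul_add, mul_add, Finset.mul_sum, Finset.mul_sum, Finset.mul_sum]
    congr 1
    · congr 1
      · refine Finset.sum_congr rfl fun i _ => ?_
        conv_lhs => rw [show (rp : ℂ) + algebraMap 𝕜 ℂ x * (rm - rp) - v i =
          (rm - rp) * (algebraMap 𝕜 ℂ x - z i) by rw [hz i]; ring]
        have := sub_ne_zero.2 ((hUz x hx).1 i)
        field_simp
      · refine Finset.sum_congr rfl fun i _ => ?_
        conv_lhs => rw [show (rp : ℂ) + algebraMap 𝕜 ℂ x * (rm - rp) - v i =
          (rm - rp) * (algebraMap 𝕜 ℂ x - z i) by rw [hz i]; ring]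
        have := sub_ne_zero.2 ((hUz x hx).1 i)
        field_simp
    · rw [hz₅, e]
      have := sub_ne_zero.2 (hUz x hx).2
      field_simp

/-- The F-homotopic transformation with arbitrary branches of the powers. -/
theorem isSolutionOn_fHomotopic_iff {𝕜 : Type*} [RCLike 𝕜] [NormedAlgebra 𝕜 ℂ]
    {z ν Q L : Fin 4 → ℂ} {z₅ L₅ : ℂ} (hz : Function.Injective z) (hz₅ : ∀ i, z₅ ≠ z i)
    (hν : ∀ i, ν i * (ν i - 1) + 1 / 2 * ν i + Q i = 0) {U : Set 𝕜} (hU : IsOpen U)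
    (hUz : ∀ x ∈ U, (∀ i, algebraMap 𝕜 ℂ x ≠ z i) ∧ algebraMap 𝕜 ℂ x ≠ z₅)
    {l : Fin 4 → 𝕜 → ℂ} (hl : ∀ i, DifferentiableOn 𝕜 (l i) U)
    (hexp : ∀ i, ∀ x ∈ U, Complex.exp (l i x) = algebraMap 𝕜 ℂ x - z i) {y w : 𝕜 → ℂ}
    (hy : ∀ x ∈ U, y x = (∏ i, Complex.exp (ν i * l i x)) * w x) :
    IsSolutionOn 1 (KNdS.preB z z₅) (KNdS.preC z Q L z₅ L₅) U y ↔
      IsSolutionOn 1 (KNdS.finalB z ν z₅) (KNdS.finalC z ν L z₅ L₅) U w := by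
  have hsub : ∀ i x, HasDerivAt (fun t : 𝕜 => algebraMap 𝕜 ℂ t - z i) 1 x := fun i x =>
    (hasDerivAt_algebraMap_complex x).sub_const _
  have hne : ∀ x ∈ U, ∀ i, algebraMap 𝕜 ℂ x - z i ≠ 0 := fun x hx i =>
    sub_ne_zero.2 ((hUz x hx).1 i)
  have hcexp : ∀ {f : 𝕜 → ℂ} {f' : ℂ} {x : 𝕜}, HasDerivAt f f' x →
      HasDerivAt (fun t => Complex.exp (f t)) (Complex.exp (f x) * f') x := fun {f f' x} hf => by
    exact HasDerivAt.cexp hf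
  -- Differentiating `exp (l i) = x - z i` determines the derivative of any differentiable branch,
  -- so the choice of branch is immaterial.
  have hl' : ∀ i, ∀ x ∈ U, HasDerivAt (l i) (algebraMap 𝕜 ℂ x - z i)⁻¹ x := fun i x hx => by
    have h₁ := ((hl i x hx).differentiableAt (hU.mem_nhds hx)).hasDerivAt
    have h₂ := (hcexp h₁).congr_of_eventuallyEq
      (f₁ := fun t : 𝕜 => algebraMap 𝕜 ℂ t - z i) (by
        filter_upwards [hU.mem_nhds hx] with t ht using (hexp i t ht).symm)
    have h₃ := h₂.unique (hsub i x)
    rw [hexp i x hx] at h₃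
    rwa [eq_inv_of_mul_eq_one_right h₃] at h₁
  refine isSolutionOn_mul_iff (E := fun x => ∏ i, Complex.exp (ν i * l i x))
    (s := fun x => ∑ i, ν i / (algebraMap 𝕜 ℂ x - z i))
    (s' := fun x => -∑ i, ν i / (algebraMap 𝕜 ℂ x - z i) ^ 2) hU
    (fun x _ => Finset.prod_ne_zero_iff.2 fun i _ => Complex.exp_ne_zero _) ?_ ?_ hy
    (fun x _ => KNdS.finalB_eq _ _ _ _)
    (fun x hx => KNdS.finalC_eq hz hz₅ hν (hUz x hx).1 (hUz x hx).2)
  · intro x hx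
    have h := hcexp (HasDerivAt.fun_sum (u := Finset.univ)
      fun i _ => (hl' i x hx).const_mul (ν i))
    simp only [Complex.exp_sum] at h
    rw [mul_comm]
    exact h
  · intro x hx
    rw [← Finset.sum_neg_distrib]
    refine HasDerivAt.fun_sum fun i _ => ?_
    have h := ((hsub i x).fun_inv (hne x hx i)).const_mul (ν i)
    have e : ν i * (-1 / (algebraMap 𝕜 ℂ x - z i) ^ 2) =
        -(ν i / (algebraMap 𝕜 ℂ x - z i) ^ 2) := by ring
    rw [e] at h
    simpa only [div_eq_mul_inv] using h

theorem mainTheorem3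
    (P : KNdS) (hΛ : P.Λ ≠ 0) (hμ : P.μ ≠ 0)
    -- the four zeros of `Δ_r` are distinct, and `r₅` is none of them
    (rp rm : ℝ) (r₃ r₄ : ℂ)
    (hroot : ∀ i, P.Delta (KNdS.radius rp rm r₃ r₄ i) = 0)
    (hinj : Function.Injective (KNdS.radius rp rm r₃ r₄))
    (h₅ : ∀ i, P.r₅ ≠ KNdS.radius rp rm r₃ r₄ i)
    -- the five points and the coefficients
    (z Q L : Fin 4 → ℂ) (z₅ L₅ : ℂ)
    (hz : ∀ i, z i = KNdS.zOf rp rm (KNdS.radius rp rm r₃ r₄ i))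
    (hz₅ : z₅ = KNdS.zOf rp rm P.r₅)
    (hQ : ∀ i, Q i = P.Q (KNdS.radius rp rm r₃ r₄ i))
    (hL : ∀ i, L i = P.L rp rm (KNdS.radius rp rm r₃ r₄ i))
    (hL₅ : L₅ = P.L₅ rp rm)
    -- `ν i` is either root of the indicial equation at `z i`
    (ν : Fin 4 → ℂ) (hν : ∀ i, ν i * (ν i - 1) + 1 / 2 * ν i + Q i = 0) :
    -- the points are `0, 1, z₃, z₄, z₅`, all distinct, and `Δ_r` factorises
    (z 0 = 0 ∧ z 1 = 1 ∧ Function.Injective z ∧ ∀ i, z₅ ≠ z i) ∧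
    (∀ x : ℂ, P.Delta (rp + x * (rm - rp)) = -P.Λ / 3 * (rm - rp) ^ 4 * ∏ i, (x - z i)) ∧
    -- the change of independent variable, for real and for complex `r`
    (∀ {𝕜 : Type} [RCLike 𝕜] [NormedAlgebra 𝕜 ℂ] [IsScalarTower ℝ 𝕜 ℂ] (U : Set 𝕜), IsOpen U →
      (∀ x ∈ U, (∀ i, algebraMap 𝕜 ℂ x ≠ z i) ∧ algebraMap 𝕜 ℂ x ≠ z₅) →
      ∀ R Rz : 𝕜 → ℂ,
      (∀ x ∈ U, Rz x = R (algebraMap ℝ 𝕜 rp + x * (algebraMap ℝ 𝕜 rm - algebraMap ℝ 𝕜 rp))) →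
      (IsSolutionOn P.Delta P.radialB P.radialC
          ((fun x => algebraMap ℝ 𝕜 rp + x * (algebraMap ℝ 𝕜 rm - algebraMap ℝ 𝕜 rp)) '' U) R ↔
        IsSolutionOn 1 (KNdS.preB z z₅) (KNdS.preC z Q L z₅ L₅) U Rz)) ∧
    -- the F-homotopic transformation, with any branches `exp (ν i * ℓ i)` of `(x - z i) ^ ν i`
    (∀ {𝕜 : Type} [RCLike 𝕜] [NormedAlgebra 𝕜 ℂ] [IsScalarTower ℝ 𝕜 ℂ] (U : Set 𝕜), IsOpen U →
      (∀ x ∈ U, (∀ i, algebraMap 𝕜 ℂ x ≠ z i) ∧ algebraMap 𝕜 ℂ x ≠ z₅) →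
      ∀ ℓ : Fin 4 → 𝕜 → ℂ, (∀ i, DifferentiableOn 𝕜 (ℓ i) U) →
      (∀ i, ∀ x ∈ U, Complex.exp (ℓ i x) = algebraMap 𝕜 ℂ x - z i) →
      ∀ R Rbar : 𝕜 → ℂ,
      (∀ x ∈ U, R (algebraMap ℝ 𝕜 rp + x * (algebraMap ℝ 𝕜 rm - algebraMap ℝ 𝕜 rp)) =
        (∏ i, Complex.exp (ν i * ℓ i x)) * Rbar x) →
      (IsSolutionOn P.Delta P.radialB P.radialC
          ((fun x => algebraMap ℝ 𝕜 rp + x * (algebraMap ℝ 𝕜 rm - algebraMap ℝ 𝕜 rp)) '' U) R ↔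
        IsSolutionOn 1 (KNdS.finalB z ν z₅) (KNdS.finalC z ν L z₅ L₅) U Rbar)) ∧
    -- exponents before the F-homotopic transformation
    (∀ i, HasExponents (KNdS.preB z z₅) (KNdS.preC z Q L z₅ L₅) (z i) (ν i) (1 / 2 - ν i)) ∧
    HasExponents (KNdS.preB z z₅) (KNdS.preC z Q L z₅ L₅) z₅ 0 2 ∧
    -- the transformed equation is Fuchsian, with its finite singular points and their exponents
    IsFuchsian (KNdS.finalB z ν z₅) (KNdS.finalC z ν L z₅ L₅) ∧
    (∀ x : ℂ, (∀ i, x ≠ z i) → x ≠ z₅ →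
      IsOrdinaryPoint (KNdS.finalB z ν z₅) (KNdS.finalC z ν L z₅ L₅) x) ∧
    (∀ i, HasExponents (KNdS.finalB z ν z₅) (KNdS.finalC z ν L z₅ L₅) (z i) 0 (1 / 2 - 2 * ν i)) ∧
    HasExponents (KNdS.finalB z ν z₅) (KNdS.finalC z ν L z₅ L₅) z₅ 0 2 ∧
    IsRegularSingularPoint (KNdS.finalB z ν z₅) (KNdS.finalC z ν L z₅ L₅) z₅ ∧
    -- `z i` can fail to be a singular point only if `ν i = -1 / 4`, which does not occur when the
    -- energy and the radius are real
    (∀ i, ν i ≠ -1 / 4 ∨ (P.ω.im = 0 ∧ (KNdS.radius rp rm r₃ r₄ i).im = 0) →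
      IsRegularSingularPoint (KNdS.finalB z ν z₅) (KNdS.finalC z ν L z₅ L₅) (z i)) := by
  have hc : (rm : ℂ) - rp ≠ 0 := by
    have h : (1 : Fin 4) ≠ 0 := by decide
    exact sub_ne_zero.2 fun e => h (hinj (by simpa [KNdS.radius] using e))
  have hv : ∀ i, KNdS.radius rp rm r₃ r₄ i = rp + z i * (rm - rp) := fun i => by
    rw [hz, KNdS.zOf, div_mul_cancel₀ _ hc]; ring
  have hr₅ : P.r₅ = rp + z₅ * (rm - rp) := by
    rw [hz₅, KNdS.zOf, div_mul_cancel₀ _ hc]; ring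
  have hz_inj : Function.Injective z := fun i j h => hinj (by rw [hv, hv, h])
  have hz₅_ne : ∀ i, z₅ ≠ z i := fun i h => h₅ i (by rw [hv, hr₅, h])
  obtain rfl : Q = _ := funext hQ
  obtain rfl : L = _ := funext hL
  subst hL₅
  set v := KNdS.radius rp rm r₃ r₄ with hv_def
  have hw := KNdS.fivePoints_injective hz_inj hz₅_ne
  have hpre := hasRegularForm_of_poles hw (KNdS.preB_poles z z₅)
    (KNdS.preC_poles z (fun i => P.Q (v i)) (fun i => P.L rp rm (v i)) z₅ (P.L₅ rp rm))
  have hfinal := hasRegularForm_of_poles hw (KNdS.finalB_poles z ν z₅)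
    (KNdS.finalC_poles' z ν (fun i => P.L rp rm (v i)) z₅ (P.L₅ rp rm))
  refine ⟨⟨?_, ?_, hz_inj, hz₅_ne⟩, ?_, ?_, ?_, ?_, ?_, ?_, ?_, ?_, ?_, ?_, ?_⟩
  · rw [hz, KNdS.zOf]; simp [hv_def, KNdS.radius]
  · rw [hz, KNdS.zOf]; simpa [hv_def, KNdS.radius] using div_self hc
  · intro x
    rw [KNdS.Delta_eq_prod hΛ hroot hinj]
    simp only [hv, Fin.prod_univ_four]
    ring
  · intro 𝕜 _ _ _ U hU hUz R Rz hR
    exact isSolutionOn_radial_iff hΛ hμ hroot hinj h₅ hc hv hr₅ hU hUz hR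
  · intro 𝕜 _ _ _ U hU hUz l hl hexp R Rbar hR
    -- Here `Rz` is taken to be the composite of `R` with the affine map, so that (b) follows from
    -- (a) and the F-homotopic equivalence.
    rw [isSolutionOn_radial_iff hΛ hμ hroot hinj h₅ hc hv hr₅ hU hUz (fun _ _ => rfl)]
    exact isSolutionOn_fHomotopic_iff hz_inj hz₅_ne hν hU hUz hl hexp hR
  · intro i
    exact ⟨_, _, hpre (some i), fun s => by
      simp only [KNdS.fivePoints, Option.elim]
      linear_combination hν i⟩
  · exact ⟨_, _, hpre none, fun s => by simp only [KNdS.fivePoints, Option.elim]; ring⟩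
  · refine isFuchsian_of_poles hw (KNdS.finalB_poles z ν z₅) (KNdS.finalC_poles z ν _ z₅ _) ?_
    rw [Fintype.sum_option]
    simp only [KNdS.fivePoints, Option.elim]
    rw [add_comm, KNdS.sum_L', KNdS.sum_L hΛ hμ hroot hinj h₅]
  · intro x hx hx₅
    refine isOrdinaryPoint_of_poles (KNdS.finalB_poles z ν z₅) (KNdS.finalC_poles' z ν _ z₅ _) ?_
    rintro (_ | i)
    exacts [hx₅, hx i]
  · intro i
    exact ⟨_, _, hfinal (some i), fun s => by
      simp only [KNdS.fivePoints, Option.elim, Pi.zero_apply]; ring⟩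
  · exact ⟨_, _, hfinal none, fun s => by simp only [KNdS.fivePoints, Option.elim]; ring⟩
  · exact ⟨not_isOrdinaryPoint_of_hasRegularForm (hfinal none) (by simp [KNdS.fivePoints]),
      _, _, hfinal none⟩
  · intro i hi
    have hne : ν i ≠ -1 / 4 := by
      rcases hi with h | ⟨hω, hr⟩
      exacts [h, KNdS.exponent_ne_neg_quarter hω hr (hν i)]
    refine ⟨not_isOrdinaryPoint_of_hasRegularForm (hfinal (some i)) fun h => hne ?_,
      _, _, hfinal (some i)⟩
    -- The residue `(1 + 4 ν i) / 2` of the first-order coefficient vanishes only for `ν i = -1/4`.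
    simp only [KNdS.fivePoints, Option.elim] at h
    linear_combination h / 2
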